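/- Let $n\ge 3$ be odd, $n=2m+1$, and let $f,g:\mathbb R^n\to\mathbb R$ be smooth and compactly supported with $0\notin\operatorname{supp} f$ and $0\notin\operatorname{supp} g$. Let $u$ be the unique $C^\infty$ solution on $\mathbb R^n\times\mathbb R$ of $u_{tt}-\Delta u=0$, $u(x,0)=f(x)$, $u_t(x,0)=0$, and let $v$ be the unique $C^\infty$ solution on $\mathbb R^n\times\mathbb R$ of $v_{tt}-\Delta v=0$, $v(x,0)=0$, $v_t(x,0)=g(x)$ (both exist). Define $(\mathcal U f)(x)=u(x,|x|)$ and $(\mathcal V g)(x)=v(x,|x|)$ for $x\in\mathbb R^n$. For every $\theta\in S^{n-1}$ the functions $s\mapsto s^{-m}(\mathcal U f)\big(\tfrac{\theta}{2s}\big)$ and $s\mapsto \frac{1}{s^{m-1}|s|}(\mathcal V g)\big(\tfrac{\theta}{2s}\big)$ are $C^\infty$ on $\mathbb R\setminus\{0\}$, and for every $x\in\mathbb R^n$ with $x\neq 0$ $$ f(x)=\frac{1}{(4\pi)^m|x|^{2m}}\int_{S^{n-1}}\partial_s^m\Big(\frac{1}{s^m}(\mathcal U f)\big(\tfrac{\theta}{2s}\big)\Big)\Big|_{s=x\cdot\theta/|x|^2}\,d\theta,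 $$ $$ g(x)=\frac{-1}{(4\pi)^m|x|^{n+1}}\int_{S^{n-1}}\partial_s^{m+1}\Big(\frac{1}{s^{m-1}|s|}(\mathcal V g)\big(\tfrac{\theta}{2s}\big)\Big)\Big|_{s=x\cdot\theta/|x|^2}\,d\theta, $$ where $d\theta$ is the surface measure on the unit sphere $S^{n-1}$; the integrands are defined for all $\theta\in S^{n-1}$ with $x\cdot\theta\ne0$, hence almost everywhere, and are integrable. -/

import Mathlib

open MeasureTheory Metric
open scoped ContDiff

noncomputable section

namespace ConeTrace

/-- `ℝⁿ` with its Euclidean norm. -/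
abbrev E (n : ℕ) : Type := EuclideanSpace ℝ (Fin n)

/-- Smooth compactly supported real functions on `ℝⁿ` whose support does not contain the origin. -/
def IsTestFunctionOffZero {n : ℕ} (h : E n → ℝ) : Prop :=
  ContDiff ℝ ∞ h ∧ HasCompactSupport h ∧ (0 : E n) ∉ tsupport h

/-- `w` is a smooth solution on `ℝⁿ × ℝ` of the initial value problem
`w_tt - Δ w = 0`, `w(x,0) = f(x)`, `w_t(x,0) = g(x)`. -/
structure IsWaveSolution {n : ℕ} (f g : E n → ℝ) (w : E n → ℝ → ℝ) : Prop where
  smooth : ContDiff ℝ ∞ (fun p : E n × ℝ => w p.1 p.2)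
  wave_eq : ∀ (x : E n) (t : ℝ),
    iteratedDeriv 2 (fun τ : ℝ => w x τ) t - Laplacian.laplacian (fun y : E n => w y t) x = 0
  initial_value : ∀ x : E n, w x 0 = f x
  initial_velocity : ∀ x : E n, deriv (fun τ : ℝ => w x τ) 0 = g x

/-- The solution of the initial value problem with data `(f, g)`. -/
def waveSolution {n : ℕ} (f g : E n → ℝ) : E n → ℝ → ℝ :=
  Classical.epsilon (IsWaveSolution f g)

/-- `(𝒰 f)(x) = u(x, |x|)`, where `u` solves the wave equation with data `(f, 0)`. -/
def U {n : ℕ} (f : E n → ℝ) (x : E n) : ℝ := waveSolution f (fun _ => 0) x ‖x‖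

/-- `(𝒱 g)(x) = v(x, |x|)`, where `v` solves the wave equation with data `(0, g)`. -/
def V {n : ℕ} (g : E n → ℝ) (x : E n) : ℝ := waveSolution (fun _ => 0) g x ‖x‖

/-- The function `s ↦ s⁻ᵐ (𝒰 f)(θ / (2 s))`. -/
def profileU {n : ℕ} (m : ℕ) (f : E n → ℝ) (θ : E n) (s : ℝ) : ℝ :=
  1 / s ^ m * U f ((1 / (2 * s)) • θ)

/-- The function `s ↦ (𝒱 g)(θ / (2 s)) / (s ^ (m - 1) |s|)`, for `m ≥ 1`. -/
def profileV {n : ℕ} (m : ℕ) (g : E n → ℝ) (θ : E n) (s : ℝ) : ℝ :=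
  1 / (s ^ (m - 1) * |s|) * V g ((1 / (2 * s)) • θ)

/-- Surface measure on the unit sphere of `ℝⁿ`. -/
def sphereMeasure (n : ℕ) : Measure (sphere (0 : E n) 1) := (volume : Measure (E n)).toSphere

end ConeTrace

end

/-! For a unit vector θ and s ≠ 0, take the point x = θ/(2s) at time |x|. In odd dimension the
solution there only sees the data near the sphere with centre x through the origin, which has the
equation s|y|² = y·θ. The inversion y = z/|z|² turns this sphere into the hyperplane z·θ = s. Hence,
up to a constant and a power of s, the trace is an s-derivative of the Radon transform of the
inverted function |z|^(-2i) f(z/|z|²): of order m with i = m for 𝒰, and of order m - 1 with i = m +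
1 for 𝒱. The Radon transform in dimension 2m + 1 is inverted by 2m derivatives followed by an
average over directions. The derivatives still missing, m or m + 1 of them, are those in the
theorem, and the inversion formula is read at z = x/|x|².

Spherical means are never used; the representation of solutions is proved in weak form. Solutions
are superpositions of plane waves. Their Gaussian averages in time are computed in
`integral_cosWave_mul_gaussian`, where an integer power of μ appears because n is odd.
`integral_mul_comp_sq_of_gaussian` passes from Gaussians to all test functions of t², each factor μ
becoming a derivative; `IsConeMean` records the outcome. `IsConeMean.integral_trace_mul` restricts
it to the cone, `IsConeMean.trace_eq` recognises the Radon transform, and `kelvin_radon_inversion`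
combines this with `radon_inversion`.

The weak formula also gives finite speed of propagation, hence uniqueness by duality, which
identifies the chosen solution `waveSolution` with the explicit one. -/

noncomputable section

namespace ConeTrace

open Set FourierTransform SchwartzMap
open scoped RealInnerProductSpace

/-! ### Polar coordinates, over rays and over full lines. -/

section Polar

variable {V : Type*} [NormedAddCommGroup V] [NormedSpace ℝ V] [FiniteDimensional ℝ V]
  [MeasurableSpace V] [BorelSpace V] [Nontrivial V] (μ : Measure V) [μ.IsAddHaarMeasure]

/-- Integration in polar coordinates, together with integrability of the radial integrals. -/
theorem integrable_and_integral_polar {H : V → ℂ} (hH : Integrable H μ) :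
    Integrable (fun θ : sphere (0 : V) 1 =>
      ∫ r in Ioi (0 : ℝ), ((r ^ (Module.finrank ℝ V - 1) : ℝ) : ℂ) * H (r • (θ : V))) μ.toSphere ∧
    ∫ θ : sphere (0 : V) 1,
      (∫ r in Ioi (0 : ℝ), ((r ^ (Module.finrank ℝ V - 1) : ℝ) : ℂ) * H (r • (θ : V)))
        ∂μ.toSphere = ∫ x, H x ∂μ := by
  have hmp := μ.measurePreserving_homeomorphUnitSphereProd
  set d := Module.finrank ℝ V - 1 with hd
  have hrad : ∀ h : ℝ → ℂ, ∫ r : Ioi (0 : ℝ), h r ∂(Measure.volumeIoiPow d)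
      = ∫ r in Ioi (0 : ℝ), ((r ^ d : ℝ) : ℂ) * h r := by
    intro h
    simp only [Measure.volumeIoiPow, ENNReal.ofReal]
    rw [integral_withDensity_eq_integral_smul,
        integral_subtype_comap measurableSet_Ioi fun a ↦ Real.toNNReal (a ^ d) • h a,
        setIntegral_congr_fun measurableSet_Ioi fun x hx ↦ ?_]
    · simp only [NNReal.smul_def, Real.coe_toNNReal _ (pow_nonneg (le_of_lt hx) d)]
      exact Complex.real_smul
    · exact (measurable_subtype_coe.pow_const _).real_toNNReal
  let K : sphere (0 : V) 1 × Ioi (0 : ℝ) → ℂ := fun p => H ((p.2 : ℝ) • (p.1 : V))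
  have hK : K ∘ homeomorphUnitSphereProd V = fun x : ({(0 : V)}ᶜ : Set V) => H x := by
    ext x
    have hx : ‖(x : V)‖ ≠ 0 := norm_ne_zero_iff.2 x.2
    simp [K, smul_smul, hx]
  have hint : Integrable K (μ.toSphere.prod (Measure.volumeIoiPow d)) := by
    rw [← hmp.integrable_comp_emb (Homeomorph.measurableEmbedding _), hK]
    have : IntegrableOn H ({(0 : V)}ᶜ) μ := hH.integrableOn
    rwa [integrableOn_iff_comap_subtypeVal (by measurability)] at this
  have h1 := hint.integral_prod_left
  have h2 := integral_prod K hint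
  have h3 : ∫ p, K p ∂(μ.toSphere.prod (Measure.volumeIoiPow d)) = ∫ x, H x ∂μ := by
    rw [← hmp.integral_comp (Homeomorph.measurableEmbedding _)]
    change ∫ x, (K ∘ homeomorphUnitSphereProd V) x ∂_ = _
    rw [hK, integral_subtype_comap (measurableSet_singleton _).compl (fun x => H x),
      restrict_compl_singleton]
  simp only [K] at h1 h2
  simp only [fun θ : sphere (0 : V) 1 => hrad (fun r => H (r • (θ : V)))] at h1 h2
  exact ⟨h1, by rw [← h2, ← h3]⟩

/-- In odd dimension, integration over all lines through the origin. -/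
theorem integrable_and_integral_polar_lines {m : ℕ} (hdim : Module.finrank ℝ V = 2 * m + 1)
    {H : V → ℂ} (hH : Integrable H μ)
    (hlines : ∀ θ : sphere (0 : V) 1,
      Integrable (fun r : ℝ => (r : ℂ) ^ (2 * m) * H (r • (θ : V)))) :
    Integrable (fun θ : sphere (0 : V) 1 =>
      ∫ r : ℝ, (r : ℂ) ^ (2 * m) * H (r • (θ : V))) μ.toSphere ∧
    ∫ θ : sphere (0 : V) 1, (∫ r : ℝ, (r : ℂ) ^ (2 * m) * H (r • (θ : V))) ∂μ.toSphere
      = 2 * ∫ x, H x ∂μ := by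
  have hd : Module.finrank ℝ V - 1 = 2 * m := by omega
  obtain ⟨h1, h2⟩ := integrable_and_integral_polar μ hH
  obtain ⟨h3, h4⟩ := integrable_and_integral_polar μ hH.comp_neg
  rw [hd] at h1 h2 h3 h4
  have hsplit : ∀ θ : sphere (0 : V) 1, ∫ r : ℝ, (r : ℂ) ^ (2 * m) * H (r • (θ : V)) =
      (∫ r in Ioi (0 : ℝ), ((r ^ (2 * m) : ℝ) : ℂ) * H (r • (θ : V))) +
      ∫ r in Ioi (0 : ℝ), ((r ^ (2 * m) : ℝ) : ℂ) * H (-(r • (θ : V))) := by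
    intro θ
    rw [← integral_add_compl (s := Ioi (0 : ℝ)) measurableSet_Ioi (hlines θ), compl_Ioi]
    congr 1
    · simp
    -- The weight r^(n-1) is even because n is odd, so the negative half-line gives the polar
    -- integral of the reflected function.
    · have := integral_comp_neg_Ioi (0 : ℝ) (fun r : ℝ => (r : ℂ) ^ (2 * m) * H (r • (θ : V)))
      rw [neg_zero] at this
      rw [← this]
      refine setIntegral_congr_fun measurableSet_Ioi fun r _ => ?_
      simp [neg_smul, Even.neg_pow (even_two_mul m)]
  simp only [hsplit]
  refine ⟨h1.add h3, ?_⟩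
  rw [integral_add h1 h3, h2, h4, integral_neg_eq_self]
  ring

end Polar

/-! ### The Radon transform through the Fourier slice theorem, and its inversion. -/

section Radon

variable {V : Type*} [NormedAddCommGroup V] [InnerProductSpace ℝ V]

theorem hasTemperateGrowth_smul_const (θ : V) :
    Function.HasTemperateGrowth (fun r : ℝ => r • θ) :=
  ((ContinuousLinearMap.id ℝ ℝ).smulRight θ).hasTemperateGrowth

theorem antilipschitzWith_smul_const {θ : V} (hθ : ‖θ‖ = 1) :
    AntilipschitzWith 1 (fun r : ℝ => r • θ) :=
  AntilipschitzWith.of_le_mul_dist fun a b => by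
    simp [dist_eq_norm, ← sub_smul, norm_smul, hθ]

variable [FiniteDimensional ℝ V] [MeasurableSpace V] [BorelSpace V]

/-- The inverse Fourier transform of `F`, restricted to the line spanned by a unit vector. -/
def fourierInvLine (F : 𝓢(V, ℂ)) {θ : V} (hθ : ‖θ‖ = 1) : 𝓢(ℝ, ℂ) :=
  compCLMOfAntilipschitz ℂ (hasTemperateGrowth_smul_const θ) (antilipschitzWith_smul_const hθ)
    (𝓕⁻ F)

theorem fourierInvLine_apply (F : 𝓢(V, ℂ)) {θ : V} (hθ : ‖θ‖ = 1) (r : ℝ) :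
    fourierInvLine F hθ r = 𝓕⁻ F (r • θ) := rfl

/-- The Radon transform of a Schwartz function in a fixed direction, as a function of the signed
distance of the hyperplane from the origin, obtained from the Fourier slice theorem. -/
def radon (F : 𝓢(V, ℂ)) {θ : V} (hθ : ‖θ‖ = 1) : 𝓢(ℝ, ℂ) := 𝓕 (fourierInvLine F hθ)

/-- This shows that `radon`, defined on the Fourier side, is the density of the push-forward of F
under z ↦ z·θ. It is the multiplication formula for the pairing L between V and the line; the sign
in L makes the transform of F an inverse Fourier transform along θ. -/
theorem integral_radon_mul (F : 𝓢(V, ℂ)) {θ : V} (hθ : ‖θ‖ = 1) (ψ : 𝓢(ℝ, ℂ)) :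
    ∫ s, radon F hθ s * ψ s = ∫ z, F z * ψ (inner ℝ z θ) := by
  let L : V →ₗ[ℝ] ℝ →ₗ[ℝ] ℝ :=
    LinearMap.mk₂ ℝ (fun z r => -(r * inner ℝ z θ)) (fun a b c => by rw [inner_add_left]; ring)
      (fun a b c => by rw [inner_smul_left]; simp; ring) (fun a b c => by ring)
      (fun a b c => by simp; ring)
  have hL : Continuous fun p : V × ℝ => L p.1 p.2 := by
    change Continuous fun p : V × ℝ => -(p.2 * inner ℝ p.1 θ)
    fun_prop
  have key := VectorFourier.integral_fourierIntegral_smul_eq_flip (μ := (volume : Measure V))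
    (ν := (volume : Measure ℝ)) (L := L) (f := F) (g := (𝓕 ψ : 𝓢(ℝ, ℂ)))
    Real.continuous_fourierChar hL F.integrable (𝓕 ψ).integrable
  have e1 : ∀ r : ℝ, VectorFourier.fourierIntegral Real.fourierChar volume L (F : V → ℂ) r
      = fourierInvLine F hθ r := by
    intro r
    rw [fourierInvLine_apply, fourierInv_coe, Real.fourierInv_eq]
    simp [VectorFourier.fourierIntegral, L, inner_smul_right]
  have e2 : ∀ z : V, VectorFourier.fourierIntegral Real.fourierChar volume L.flip
      ((𝓕 ψ : 𝓢(ℝ, ℂ)) : ℝ → ℂ) z = ψ (inner ℝ z θ) := by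
    intro z
    have : 𝓕⁻ (𝓕 ψ) (inner ℝ z θ) = ψ (inner ℝ z θ) := by simp
    rw [← this, fourierInv_coe, Real.fourierInv_eq]
    simp [VectorFourier.fourierIntegral, L]
    refine integral_congr_ae (.of_forall fun r => ?_)
    simp only [mul_comm]
  simp only [e1, e2, smul_eq_mul] at key
  rw [← key]
  have := SchwartzMap.integral_fourier_mul_eq (fourierInvLine F hθ) ψ
  simpa [radon] using this

theorem iteratedDeriv_radon (F : 𝓢(V, ℂ)) {θ : V} (hθ : ‖θ‖ = 1) (k : ℕ) (s : ℝ) :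
    iteratedDeriv k (radon F hθ) s = ∫ r : ℝ, ((Real.fourierChar (-(r * s)) : Circle) : ℂ) *
      ((-2 * Real.pi * Complex.I * r) ^ k * fourierInvLine F hθ r) := by
  have h : ∀ n : ℕ, ((n : ℕ∞)) ≤ (⊤ : ℕ∞) →
      Integrable (fun x : ℝ => x ^ n • fourierInvLine F hθ x) := by
    intro n _
    have := (fourierInvLine F hθ).integrable_pow_mul volume n
    refine this.mono' (by fun_prop) (.of_forall fun x => ?_)
    simp
  rw [radon, fourier_coe, Real.iteratedDeriv_fourier h le_top, Real.fourier_eq]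
  refine integral_congr_ae (.of_forall fun r => ?_)
  simp [Circle.smul_def, mul_comm]

/-- Filtered back-projection: inversion of the Radon transform in odd dimension. -/
theorem radon_inversion {m : ℕ} (hdim : Module.finrank ℝ V = 2 * m + 1) (F : 𝓢(V, ℂ)) (z : V) :
    Integrable (fun θ : sphere (0 : V) 1 =>
      iteratedDeriv (2 * m) (radon F (norm_eq_of_mem_sphere θ)) (inner ℝ z (θ : V)))
      (volume : Measure V).toSphere ∧
    ∫ θ : sphere (0 : V) 1, iteratedDeriv (2 * m) (radon F (norm_eq_of_mem_sphere θ))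
      (inner ℝ z (θ : V)) ∂(volume : Measure V).toSphere
      = 2 * (-1) ^ m * (2 * Real.pi) ^ (2 * m) * F z := by
  have : Nontrivial V := Module.nontrivial_of_finrank_pos (R := ℝ) (by omega)
  -- The integral of H is F z by Fourier inversion.
  let H : V → ℂ := fun ξ => ((Real.fourierChar (-(inner ℝ ξ z)) : Circle) : ℂ) * 𝓕⁻ F ξ
  have hHn : ∀ ξ, ‖H ξ‖ = ‖𝓕⁻ F ξ‖ := fun ξ => by
    rw [norm_mul, Circle.norm_coe, one_mul]
  have hHc : Continuous H := by
    have := (𝓕⁻ F).continuous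
    fun_prop
  have hH : Integrable H := by
    refine (𝓕⁻ F).integrable.mono hHc.aestronglyMeasurable (.of_forall fun ξ => (hHn ξ).le)
  have hl : ∀ θ : sphere (0 : V) 1,
      Integrable (fun r : ℝ => (r : ℂ) ^ (2 * m) * H (r • (θ : V))) := by
    intro θ
    have := (fourierInvLine F (norm_eq_of_mem_sphere θ)).integrable_pow_mul volume (2 * m)
    refine this.mono' (by fun_prop) (.of_forall fun x => ?_)
    rw [norm_mul, hHn, ← fourierInvLine_apply F (norm_eq_of_mem_sphere θ)]
    simp
  obtain ⟨h1, h2⟩ := integrable_and_integral_polar_lines volume hdim hH hl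
  have e : ∀ θ : sphere (0 : V) 1, iteratedDeriv (2 * m) (radon F (norm_eq_of_mem_sphere θ))
      (inner ℝ z (θ : V)) = ((-1) ^ m * (2 * Real.pi) ^ (2 * m)) *
        ∫ r : ℝ, (r : ℂ) ^ (2 * m) * H (r • (θ : V)) := by
    intro θ
    rw [iteratedDeriv_radon, ← integral_const_mul]
    refine integral_congr_ae (.of_forall fun r => ?_)
    have hin : inner ℝ (r • (θ : V)) z = r * inner ℝ z (θ : V) := by
      rw [real_inner_smul_left, real_inner_comm]
    simp only [H, fourierInvLine_apply, hin]
    -- The symbol of 2m derivatives is a constant times r^(2m), exactly the polar density r^(n-1).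
    -- In odd dimension no absolute value of r occurs, so the inversion is a pure differentiation.
    have : (-2 * Real.pi * Complex.I * r : ℂ) ^ (2 * m)
        = (-1) ^ m * (2 * Real.pi) ^ (2 * m) * (r : ℂ) ^ (2 * m) := by
      rw [show (-2 * Real.pi * Complex.I * r : ℂ) = Complex.I * (-(2 * Real.pi) * r) by ring,
        mul_pow, pow_mul Complex.I, Complex.I_sq, mul_pow, Even.neg_pow (even_two_mul m)]
      ring
    rw [this]
    ring
  simp only [e]
  refine ⟨h1.const_mul _, ?_⟩
  rw [integral_const_mul, h2]
  have : ∫ ξ, H ξ = F z := by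
    have h : 𝓕 (𝓕⁻ F) z = F z := by simp
    rw [← h, fourier_coe, Real.fourier_eq]
    rfl
  rw [this]
  ring

end Radon

/-! ### Superpositions of plane waves and their derivatives. -/

section WaveIntegral

/-- The pairing on phase space that expresses `wave` as a Fourier integral. -/
def phasePairing (V : Type*) [NormedAddCommGroup V] [InnerProductSpace ℝ V] :
    (V × ℝ) →L[ℝ] (V × ℝ) →L[ℝ] ℝ :=
  LinearMap.mkContinuous₂
    (LinearMap.mk₂ ℝ (fun p q : V × ℝ => -(inner ℝ p.1 q.1 + p.2 * q.2))
      (fun a b c => by simp [inner_add_left]; ring) (fun a b c => by simp [inner_smul_left]; ring)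
      (fun a b c => by simp [inner_add_right]; ring)
      (fun a b c => by simp [inner_smul_right]; ring)) 2 (fun p q => by
        simp only [LinearMap.mk₂_apply, norm_neg]
        refine (norm_add_le _ _).trans ?_
        have h1 : ‖inner ℝ p.1 q.1‖ ≤ ‖p‖ * ‖q‖ := (norm_inner_le_norm _ _).trans
          (mul_le_mul (norm_fst_le p) (norm_fst_le q) (norm_nonneg _) (norm_nonneg _))
        have h2 : ‖p.2 * q.2‖ ≤ ‖p‖ * ‖q‖ := (norm_mul _ _).le.trans
          (mul_le_mul (norm_snd_le p) (norm_snd_le q) (norm_nonneg _) (norm_nonneg _))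
        linarith)

theorem phasePairing_apply {V : Type*} [NormedAddCommGroup V] [InnerProductSpace ℝ V] (p q : V × ℝ) :
    phasePairing V p q = -(inner ℝ p.1 q.1 + p.2 * q.2) := rfl

variable {V : Type*} [NormedAddCommGroup V] [InnerProductSpace ℝ V] [FiniteDimensional ℝ V]
  [MeasurableSpace V] [BorelSpace V]

/-- A measurable function all of whose moments are integrable. -/
structure HasMoments (a : V → ℂ) : Prop where
  measurable : Measurable a
  integrable : ∀ k : ℕ, Integrable (fun ξ => ‖ξ‖ ^ k * ‖a ξ‖)

/-- The superposition of the plane waves with phase `ξ · x + t ‖ξ‖` and amplitude `a`. -/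
def wave (a : V → ℂ) (x : V) (t : ℝ) : ℂ :=
  ∫ ξ, ((Real.fourierChar (inner ℝ ξ x + ‖ξ‖ * t) : Circle) : ℂ) * a ξ

theorem measurable_graph {V : Type*} [NormedAddCommGroup V] [MeasurableSpace V] [BorelSpace V]
    [SecondCountableTopology V] : Measurable (fun ξ : V => (ξ, ‖ξ‖)) := by
  fun_prop

/-- Lebesgue measure on the graph of the norm. -/
def graphMeasure (V : Type*) [NormedAddCommGroup V] [InnerProductSpace ℝ V]
    [FiniteDimensional ℝ V] [MeasurableSpace V] [BorelSpace V] : Measure (V × ℝ) :=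
  (volume : Measure V).map (fun ξ => (ξ, ‖ξ‖))

theorem fourierIntegral_graph {h : V × ℝ → ℂ} (hh : Measurable h) (p : V × ℝ) :
    VectorFourier.fourierIntegral Real.fourierChar (graphMeasure V)
      (phasePairing V).toLinearMap₁₂ h p =
    ∫ ξ, ((Real.fourierChar (inner ℝ ξ p.1 + ‖ξ‖ * p.2) : Circle) : ℂ) * h (ξ, ‖ξ‖) := by
  rw [VectorFourier.fourierIntegral, graphMeasure, integral_map measurable_graph.aemeasurable]
  · refine integral_congr_ae (.of_forall fun ξ => ?_)
    have : -((phasePairing V).toLinearMap₁₂ (ξ, ‖ξ‖) p) = inner ℝ ξ p.1 + ‖ξ‖ * p.2 := by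
      change -(phasePairing V (ξ, ‖ξ‖) p) = _
      rw [phasePairing_apply, neg_neg]
    simp only [this, Circle.smul_def, smul_eq_mul]
  · have : Continuous fun q : V × ℝ => (Real.fourierChar (-(phasePairing V q p)) : Circle) := by
      fun_prop
    exact this.aestronglyMeasurable.fun_smul hh.aestronglyMeasurable

/-- Seen as the Fourier integral of a measure on the cone {(ξ, |ξ|)}, the wave is jointly smooth in
(x, t) as soon as the moments of the amplitude are finite, although |ξ| is not smooth at 0. -/
theorem wave_eq_fourierIntegral {a : V → ℂ} (ha : Measurable a) (p : V × ℝ) :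
    wave a p.1 p.2 = VectorFourier.fourierIntegral Real.fourierChar (graphMeasure V)
      (phasePairing V).toLinearMap₁₂ (fun q => a q.1) p :=
  (fourierIntegral_graph (ha.comp measurable_fst) p).symm

theorem HasMoments.integrable_graph {a : V → ℂ} (ha : HasMoments a) (k : ℕ) :
    Integrable (fun q : V × ℝ => ‖q‖ ^ k * ‖a q.1‖) (graphMeasure V) := by
  rw [graphMeasure, integrable_map_measure _ measurable_graph.aemeasurable]
  · refine (ha.integrable k).congr (.of_forall fun ξ => ?_)
    simp [Prod.norm_def]
  · have := ha.measurable
    exact Measurable.aestronglyMeasurable (by fun_prop)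

theorem HasMoments.integrable_self {a : V → ℂ} (ha : HasMoments a) : Integrable a := by
  have := ha.integrable 0
  simp only [pow_zero, one_mul] at this
  exact (integrable_norm_iff ha.measurable.aestronglyMeasurable).1 this

theorem HasMoments.contDiff_wave {a : V → ℂ} (ha : HasMoments a) :
    ContDiff ℝ ∞ (fun p : V × ℝ => wave a p.1 p.2) := by
  simp only [wave_eq_fourierIntegral ha.measurable]
  exact VectorFourier.contDiff_fourierIntegral (phasePairing V) (N := ⊤)
    (fun k _ => ha.integrable_graph k)

/-- Multiplication of the amplitude by the symbol of a directional derivative. -/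
theorem HasMoments.symbol {a : V → ℂ} (ha : HasMoments a) (y : V) (τ : ℝ) :
    HasMoments fun ξ => 2 * Real.pi * Complex.I * (inner ℝ ξ y + ‖ξ‖ * τ : ℝ) * a ξ where
  measurable := by
    have := ha.measurable
    fun_prop
  integrable k := by
    have hm := ha.measurable
    refine ((ha.integrable (k + 1)).const_mul (2 * Real.pi * (‖y‖ + |τ|))).mono'
      (Measurable.aestronglyMeasurable (by fun_prop)) (.of_forall fun ξ => ?_)
    have h1 : |inner ℝ ξ y + ‖ξ‖ * τ| ≤ ‖ξ‖ * (‖y‖ + |τ|) := by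
      refine (abs_add_le _ _).trans ?_
      have := abs_real_inner_le_norm ξ y
      rw [abs_mul, abs_norm]
      linarith
    have hpi := Real.pi_pos
    have h2 : ‖(2 * Real.pi * Complex.I * (inner ℝ ξ y + ‖ξ‖ * τ : ℝ) * a ξ : ℂ)‖
        = 2 * Real.pi * |inner ℝ ξ y + ‖ξ‖ * τ| * ‖a ξ‖ := by
      rw [norm_mul, norm_mul, norm_mul, norm_mul, Complex.norm_I, Complex.norm_real,
        Complex.norm_real, Complex.norm_ofNat, Real.norm_eq_abs, Real.norm_eq_abs,
        abs_of_pos hpi, mul_one]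
    rw [norm_mul, norm_norm, norm_pow, norm_norm, h2]
    calc _ ≤ ‖ξ‖ ^ k * (2 * Real.pi * (‖ξ‖ * (‖y‖ + |τ|)) * ‖a ξ‖) := by gcongr
      _ = _ := by ring

theorem HasMoments.hasFDerivAt_wave {a : V → ℂ} (ha : HasMoments a) (x : V) (t : ℝ) :
    ∃ D : V × ℝ →L[ℝ] ℂ, HasFDerivAt (fun p : V × ℝ => wave a p.1 p.2) D (x, t) ∧
      ∀ y τ, D (y, τ) = wave (fun ξ => 2 * Real.pi * Complex.I *
        (inner ℝ ξ y + ‖ξ‖ * τ : ℝ) * a ξ) x t := by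
  have h0 : Integrable (fun q : V × ℝ => a q.1) (graphMeasure V) := by
    have := ha.integrable_graph 0
    simp only [pow_zero, one_mul] at this
    exact (integrable_norm_iff (ha.measurable.comp measurable_fst).aestronglyMeasurable).1 this
  have h1 := ha.integrable_graph 1
  simp only [pow_one] at h1
  have key := VectorFourier.hasFDerivAt_fourierIntegral (phasePairing V) h0 h1 (x, t)
  have hw : (fun p : V × ℝ => wave a p.1 p.2) = VectorFourier.fourierIntegral Real.fourierChar
      (graphMeasure V) (phasePairing V).toLinearMap₁₂ (fun q => a q.1) :=
    funext (wave_eq_fourierIntegral ha.measurable)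
  rw [← hw] at key
  refine ⟨_, key, fun y τ => ?_⟩
  rw [VectorFourier.fourierIntegral_continuousLinearMap_apply Real.continuous_fourierChar]
  · rw [fourierIntegral_graph]
    · refine integral_congr_ae (.of_forall fun ξ => ?_)
      simp [phasePairing_apply]
      ring
    · have := ha.measurable
      change Measurable fun q : V × ℝ => -(2 * Real.pi * Complex.I) *
        (phasePairing V q (y, τ) • a q.1)
      fun_prop
  · obtain ⟨C, hC⟩ : ∃ C : ℝ, ∀ q : V × ℝ, ‖VectorFourier.fourierSMulRight (phasePairing V)
        (fun q : V × ℝ => a q.1) q‖ ≤ C * ‖q‖ * ‖a q.1‖ :=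
      ⟨_, fun q => VectorFourier.norm_fourierSMulRight_le _ _ _⟩
    refine (h1.const_mul C).mono' ?_ (.of_forall fun q => ?_)
    · exact AEStronglyMeasurable.fourierSMulRight (L := phasePairing V)
        (ha.measurable.comp measurable_fst).aestronglyMeasurable
    · rw [← mul_assoc]
      exact hC q

theorem HasMoments.hasDerivAt_wave_time {a : V → ℂ} (ha : HasMoments a) (x : V) (t : ℝ) :
    HasDerivAt (fun τ => wave a x τ)
      (wave (fun ξ => 2 * Real.pi * Complex.I * (‖ξ‖ : ℝ) * a ξ) x t) t := by
  obtain ⟨D, hD, h⟩ := ha.hasFDerivAt_wave x t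
  have h2 : HasDerivAt (fun τ : ℝ => ((x, τ) : V × ℝ)) (0, 1) t :=
    (hasDerivAt_const t x).prodMk (hasDerivAt_id t)
  have := hD.comp_hasDerivAt t h2
  rw [h] at this
  simpa [Function.comp_def] using this

theorem HasMoments.hasFDerivAt_wave_space {a : V → ℂ} (ha : HasMoments a) (x : V) (t : ℝ) :
    ∃ D : V →L[ℝ] ℂ, HasFDerivAt (fun y => wave a y t) D x ∧
      ∀ y, D y = wave (fun ξ => 2 * Real.pi * Complex.I * (inner ℝ ξ y : ℝ) * a ξ) x t := by
  obtain ⟨D, hD, h⟩ := ha.hasFDerivAt_wave x t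
  have h2 : HasFDerivAt (fun y : V => ((y, t) : V × ℝ)) (ContinuousLinearMap.inl ℝ V ℝ) x :=
    hasFDerivAt_prodMk_left x t
  refine ⟨D.comp (ContinuousLinearMap.inl ℝ V ℝ), HasFDerivAt.comp (f := fun y : V => (y, t)) x hD h2,
    fun y => ?_⟩
  simpa using h y 0

theorem HasMoments.symbol_space {a : V → ℂ} (ha : HasMoments a) (y : V) :
    HasMoments fun ξ => 2 * Real.pi * Complex.I * (inner ℝ ξ y : ℝ) * a ξ := by
  simpa using ha.symbol y 0

theorem HasMoments.symbol_time {a : V → ℂ} (ha : HasMoments a) :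
    HasMoments fun ξ => 2 * Real.pi * Complex.I * (‖ξ‖ : ℝ) * a ξ := by
  simpa using ha.symbol 0 1

theorem HasMoments.integrable_wave {a : V → ℂ} (ha : HasMoments a) (x : V) (t : ℝ) :
    Integrable fun ξ => ((Real.fourierChar (inner ℝ ξ x + ‖ξ‖ * t) : Circle) : ℂ) * a ξ := by
  refine ha.integrable_self.mono ?_ (.of_forall fun ξ => ?_)
  · have := ha.measurable
    exact Measurable.aestronglyMeasurable (by fun_prop)
  · rw [norm_mul, Circle.norm_coe, one_mul]

theorem norm_wave_le (a : V → ℂ) (x : V) (t : ℝ) :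
    ‖wave a x t‖ ≤ ∫ ξ, ‖a ξ‖ := by
  refine (norm_integral_le_integral_norm _).trans_eq (integral_congr_ae (.of_forall fun ξ => ?_))
  simp only [norm_mul, Circle.norm_coe, one_mul]

theorem HasMoments.contDiff_wave_space {a : V → ℂ} (ha : HasMoments a) (t : ℝ) :
    ContDiff ℝ ∞ (fun x => wave a x t) :=
  ha.contDiff_wave.comp (contDiff_id.prodMk contDiff_const)

/-- The superposition of plane waves solves the wave equation. -/
theorem HasMoments.laplacian_wave {a : V → ℂ} (ha : HasMoments a) (x : V) (t : ℝ) :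
    Laplacian.laplacian (fun y => wave a y t) x =
      wave (fun ξ => 2 * Real.pi * Complex.I * (‖ξ‖ : ℝ) *
        (2 * Real.pi * Complex.I * (‖ξ‖ : ℝ) * a ξ)) x t := by
  let b := stdOrthonormalBasis ℝ V
  rw [congrFun (InnerProductSpace.laplacian_eq_iteratedFDeriv_orthonormalBasis _ b) x]
  have hf : ∀ (c : V → ℂ) (hc : HasMoments c) (y e : V), fderiv ℝ (fun y => wave c y t) y e =
      wave (fun ξ => 2 * Real.pi * Complex.I * (inner ℝ ξ e : ℝ) * c ξ) y t := by
    intro c hc y e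
    obtain ⟨D, hD, h⟩ := hc.hasFDerivAt_wave_space y t
    rw [hD.fderiv, h]
  have h1 : ∀ e : V, iteratedFDeriv ℝ 2 (fun y => wave a y t) x ![e, e] =
      wave (fun ξ => 2 * Real.pi * Complex.I * (inner ℝ ξ e : ℝ) *
        (2 * Real.pi * Complex.I * (inner ℝ ξ e : ℝ) * a ξ)) x t := by
    intro e
    rw [iteratedFDeriv_two_apply]
    simp only [Matrix.cons_val_zero, Matrix.cons_val_one]
    have hd : DifferentiableAt ℝ (fderiv ℝ fun y => wave a y t) x :=
      ((ha.contDiff_wave_space t).fderiv_right (m := 1) (by norm_cast)).differentiable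
        (by norm_num) x
    have : fderiv ℝ (fderiv ℝ fun y => wave a y t) x e e =
        fderiv ℝ (fun y => fderiv ℝ (fun y => wave a y t) y e) x e := by
      rw [fderiv_clm_apply hd (by fun_prop)]
      simp
    rw [this]
    simp only [hf a ha]
    rw [hf _ (ha.symbol_space e)]
  rw [Finset.sum_congr rfl fun i _ => h1 (b i)]
  unfold wave
  rw [← integral_finsetSum]
  · refine integral_congr_ae (.of_forall fun ξ => ?_)
    -- Parseval: the squared symbols of the directional derivatives add up to the square of the
    -- symbol of ∂_t.
    have hb : ∑ i, (inner ℝ ξ (b i) : ℝ) ^ 2 = ‖ξ‖ ^ 2 := by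
      rw [← b.sum_sq_norm_inner_left ξ]
      simp
    have hb' : ∑ i, ((inner ℝ ξ (b i) : ℝ) : ℂ) ^ 2 = ((‖ξ‖ : ℝ) : ℂ) ^ 2 := by
      exact_mod_cast hb
    calc _ = ∑ i, ((inner ℝ ξ (b i) : ℝ) : ℂ) ^ 2 *
          (((Real.fourierChar (inner ℝ ξ x + ‖ξ‖ * t) : Circle) : ℂ) *
            ((2 * Real.pi * Complex.I) ^ 2 * a ξ)) := by
          refine Finset.sum_congr rfl fun i _ => ?_
          ring
      _ = _ := by
          rw [← Finset.sum_mul, hb']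
          ring
  · intro i _
    exact ((ha.symbol_space (b i)).symbol_space (b i)).integrable_wave x t

end WaveIntegral

/-! ### Even and odd solutions in time. -/

section Solutions

variable {V : Type*} [NormedAddCommGroup V] [InnerProductSpace ℝ V] [FiniteDimensional ℝ V]
  [MeasurableSpace V] [BorelSpace V]

theorem hasMoments_schwartz (F : 𝓢(V, ℂ)) : HasMoments F :=
  ⟨F.continuous.measurable, fun k => F.integrable_pow_mul volume k⟩

/-- The amplitude of the sine solution is singular at ξ = 0, but 1/|ξ| is locally integrable in
dimension at least 2. Only the moment of order 0 needs this; the higher ones absorb the singularity.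
-/
theorem hasMoments_div_norm (hdim : 2 ≤ Module.finrank ℝ V) (F : 𝓢(V, ℂ)) :
    HasMoments fun ξ => F ξ / (2 * Real.pi * Complex.I * (‖ξ‖ : ℝ)) := by
  have hm : Measurable (F : V → ℂ) := F.continuous.measurable
  have : Nontrivial V := Module.nontrivial_of_finrank_pos (R := ℝ) (by omega)
  have hn : ∀ ξ : V, ‖F ξ / (2 * Real.pi * Complex.I * (‖ξ‖ : ℝ))‖ =
      (2 * Real.pi)⁻¹ * (‖ξ‖⁻¹ * ‖F ξ‖) := by
    intro ξ
    rw [norm_div, norm_mul, norm_mul, norm_mul, Complex.norm_I, Complex.norm_real,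
      Complex.norm_real, Complex.norm_ofNat, Real.norm_eq_abs, Real.norm_eq_abs,
      abs_of_pos Real.pi_pos, abs_norm]
    rw [mul_one, div_eq_mul_inv, mul_inv]
    ring
  have h0 : Integrable fun ξ => ‖ξ‖⁻¹ * ‖F ξ‖ := by
    obtain ⟨C, hC⟩ := F.decay 0 0
    simp only [pow_zero, norm_iteratedFDeriv_zero, one_mul] at hC
    rw [← integrableOn_univ, ← union_compl_self (ball (0 : V) 1)]
    refine IntegrableOn.union ?_ ?_
    · have hb : IntegrableOn (fun x : V => ‖x‖⁻¹) (ball (0 : V) 1) := by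
        rw [integrableOn_fun_norm_addHaar volume (f := fun r : ℝ => r⁻¹)]
        have : IntegrableOn (fun y : ℝ => y ^ (Module.finrank ℝ V - 2)) (Ioo 0 1) :=
          ((continuous_pow _).integrableOn_Icc (a := 0) (b := 1)).mono_set Ioo_subset_Icc_self
        refine this.congr_fun (fun y hy => ?_) measurableSet_Ioo
        have hy0 : y ≠ 0 := hy.1.ne'
        rw [show Module.finrank ℝ V - 1 = Module.finrank ℝ V - 2 + 1 by omega, pow_succ]
        simp [hy0]
      refine (hb.mul_const C).mono' (Measurable.aestronglyMeasurable (by fun_prop))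
        (.of_forall fun ξ => ?_)
      rw [norm_mul, norm_norm, norm_inv, norm_norm]
      gcongr
      exact hC.2 ξ
    · refine F.integrable.norm.integrableOn.mono'
        (Measurable.aestronglyMeasurable (by fun_prop)) ?_
      filter_upwards [ae_restrict_mem measurableSet_ball.compl] with ξ hξ
      have : 1 ≤ ‖ξ‖ := by simpa using hξ
      rw [norm_mul, norm_norm, norm_inv, norm_norm]
      exact mul_le_of_le_one_left (norm_nonneg _) (inv_le_one_of_one_le₀ this)
  refine ⟨by fun_prop, fun k => ?_⟩
  simp only [hn]
  cases k with
  | zero => simpa using h0.const_mul _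
  | succ k =>
    refine ((F.integrable_pow_mul volume k).const_mul (2 * Real.pi)⁻¹).mono'
      (Measurable.aestronglyMeasurable (by fun_prop)) (.of_forall fun ξ => ?_)
    rw [Real.norm_of_nonneg (by positivity)]
    rcases eq_or_ne ‖ξ‖ 0 with h | h
    · rw [h]
      simp
      positivity
    · apply le_of_eq
      field_simp
      ring

theorem wave_fourier_zero (F : 𝓢(V, ℂ)) (x : V) : wave (𝓕 F : 𝓢(V, ℂ)) x 0 = F x := by
  have : 𝓕⁻ (𝓕 F) x = F x := by simp
  rw [← this, fourierInv_coe, Real.fourierInv_eq]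
  simp only [wave, mul_zero, add_zero]
  rfl

/-- The even and odd (in time) superpositions of plane waves, for `ε = 1` and `ε = -1`. -/
def parityWave (ε : ℝ) (a : V → ℂ) (x : V) (t : ℝ) : ℂ :=
  (wave a x t + ε * wave a x (-t)) / 2

theorem HasMoments.contDiff_parityWave {a : V → ℂ} (ha : HasMoments a) (ε : ℝ) :
    ContDiff ℝ ∞ (fun p : V × ℝ => parityWave ε a p.1 p.2) := by
  have h1 := ha.contDiff_wave
  have h2 : ContDiff ℝ ∞ (fun p : V × ℝ => wave a p.1 (-p.2)) :=
    h1.comp (contDiff_fst.prodMk contDiff_snd.neg)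
  exact (h1.add (contDiff_const.mul h2)).div_const 2

/-- Time reversal contributes a sign, so each time derivative exchanges even and odd waves. -/
theorem HasMoments.hasDerivAt_parityWave {a : V → ℂ} (ha : HasMoments a) (ε : ℝ) (x : V) (t : ℝ) :
    HasDerivAt (fun τ => parityWave ε a x τ)
      (parityWave (-ε) (fun ξ => 2 * Real.pi * Complex.I * (‖ξ‖ : ℝ) * a ξ) x t) t := by
  have h1 := ha.hasDerivAt_wave_time x t
  have h2 := (ha.hasDerivAt_wave_time x (-t)).scomp t (hasDerivAt_neg t)
  convert! (h1.add (h2.const_mul (ε : ℂ))).div_const 2 using 1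
  simp [parityWave]

theorem HasMoments.laplacian_parityWave {a : V → ℂ} (ha : HasMoments a) (ε : ℝ) (x : V) (t : ℝ) :
    Laplacian.laplacian (fun y => parityWave ε a y t) x =
      parityWave ε (fun ξ => 2 * Real.pi * Complex.I * (‖ξ‖ : ℝ) *
        (2 * Real.pi * Complex.I * (‖ξ‖ : ℝ) * a ξ)) x t := by
  have hc : ∀ s, ContDiffAt ℝ 2 (fun y => wave a y s) x := fun s =>
    ((ha.contDiff_wave_space s).of_le (by norm_cast)).contDiffAt
  have e : (fun y => parityWave ε a y t) = (1 / 2 : ℝ) • ((fun y => wave a y t) +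
      ε • fun y => wave a y (-t)) := by
    ext y
    simp [parityWave]
    ring
  have hε : ContDiffAt ℝ 2 (ε • fun y => wave a y (-t)) x := (hc (-t)).const_smul ε
  have hs : ContDiffAt ℝ 2 ((fun y => wave a y t) + ε • fun y => wave a y (-t)) x := (hc t).add hε
  rw [e, InnerProductSpace.laplacian_smul _ hs, ContDiffAt.laplacian_add (hc t) hε,
    InnerProductSpace.laplacian_smul _ (hc (-t)), ha.laplacian_wave, ha.laplacian_wave]
  simp [parityWave]
  ring

end Solutions

/-- Two time derivatives and the Laplacian both multiply the amplitude by (2πi|ξ|)². The data are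
left as values at time 0, so that the cosine and the sine solutions are both instances. -/
theorem isWaveSolution_parityWave {n : ℕ} {a : E n → ℂ} (ha : HasMoments a) (ε : ℝ) :
    IsWaveSolution (fun x => (parityWave ε a x 0).re)
      (fun x => (parityWave (-ε) (fun ξ => 2 * Real.pi * Complex.I * (‖ξ‖ : ℝ) * a ξ) x 0).re)
      (fun x t => (parityWave ε a x t).re) := by
  have hd : ∀ {b : E n → ℂ} (_ : HasMoments b) (δ : ℝ) (x : E n) (t : ℝ),
      HasDerivAt (fun τ => (parityWave δ b x τ).re)
        (parityWave (-δ) (fun ξ => 2 * Real.pi * Complex.I * (‖ξ‖ : ℝ) * b ξ) x t).re t := by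
    intro b hb δ x t
    exact Complex.reCLM.hasFDerivAt.comp_hasDerivAt t (hb.hasDerivAt_parityWave δ x t)
  refine ⟨Complex.reCLM.contDiff.comp (ha.contDiff_parityWave ε), fun x t => ?_,
    fun x => rfl, fun x => (hd ha ε x 0).deriv⟩
  have e1 : iteratedDeriv 2 (fun τ : ℝ => (parityWave ε a x τ).re) t =
      (parityWave ε (fun ξ => 2 * Real.pi * Complex.I * (‖ξ‖ : ℝ) *
        (2 * Real.pi * Complex.I * (‖ξ‖ : ℝ) * a ξ)) x t).re := by
    rw [iteratedDeriv_succ, iteratedDeriv_one]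
    have : deriv (fun τ : ℝ => (parityWave ε a x τ).re) = fun t =>
        (parityWave (-ε) (fun ξ => 2 * Real.pi * Complex.I * (‖ξ‖ : ℝ) * a ξ) x t).re :=
      funext fun t => (hd ha ε x t).deriv
    rw [this, (hd ha.symbol_time (-ε) x t).deriv, neg_neg]
  have hc : ContDiffAt ℝ 2 (fun y => parityWave ε a y t) x :=
    (((ha.contDiff_parityWave ε).comp (contDiff_id.prodMk contDiff_const)).of_le
      (by norm_cast)).contDiffAt
  have e2 := hc.laplacian_CLM_comp_left (l := Complex.reCLM)
  rw [Function.comp_apply, ha.laplacian_parityWave] at e2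
  rw [e1, sub_eq_zero]
  exact e2.symm

/-- A smooth compactly supported real function as a complex Schwartz function. -/
def toSchwartz {n : ℕ} (f : E n → ℝ) (hf : ContDiff ℝ ∞ f) (hc : HasCompactSupport f) :
    𝓢(E n, ℂ) :=
  HasCompactSupport.toSchwartzMap (f := fun x => (f x : ℂ))
    (hc.comp_left (g := fun r : ℝ => (r : ℂ)) Complex.ofReal_zero)
    (Complex.ofRealCLM.contDiff.comp hf)

theorem toSchwartz_apply {n : ℕ} (f : E n → ℝ) (hf : ContDiff ℝ ∞ f) (hc : HasCompactSupport f)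
    (x : E n) : toSchwartz f hf hc x = f x := rfl

/-- The solution of the wave equation with data `(F, 0)`. -/
def cosWave {n : ℕ} (F : 𝓢(E n, ℂ)) (x : E n) (t : ℝ) : ℂ := parityWave 1 (𝓕 F : 𝓢(E n, ℂ)) x t

/-- The solution of the wave equation with data `(0, F)`. -/
def sinWave {n : ℕ} (F : 𝓢(E n, ℂ)) (x : E n) (t : ℝ) : ℂ :=
  parityWave (-1) (fun ξ => (𝓕 F : 𝓢(E n, ℂ)) ξ / (2 * Real.pi * Complex.I * (‖ξ‖ : ℝ))) x t

theorem isWaveSolution_cosWave {n : ℕ} (F : 𝓢(E n, ℂ)) :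
    IsWaveSolution (fun x => (F x).re) (fun _ => 0) (fun x t => (cosWave F x t).re) := by
  have h := isWaveSolution_parityWave (hasMoments_schwartz (𝓕 F : 𝓢(E n, ℂ))) 1
  have e1 : ∀ x, parityWave 1 (𝓕 F : 𝓢(E n, ℂ)) x 0 = F x := fun x => by
    simp [parityWave, wave_fourier_zero]
  have e2 : ∀ x, parityWave (-1) (fun ξ => 2 * Real.pi * Complex.I * (‖ξ‖ : ℝ) *
      (𝓕 F : 𝓢(E n, ℂ)) ξ) x 0 = 0 := fun x => by
    simp [parityWave]
  simp only [e1, e2, Complex.zero_re] at h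
  exact h

theorem wave_congr_ae {n : ℕ} {a b : E n → ℂ} (h : a =ᵐ[volume] b) (x : E n) (t : ℝ) :
    wave a x t = wave b x t :=
  integral_congr_ae (h.mono fun ξ hξ => by simp only [hξ])

theorem norm_mul_div_norm_ae {n : ℕ} (hn : 1 ≤ n) (F : 𝓢(E n, ℂ)) :
    (fun ξ : E n => 2 * Real.pi * Complex.I * (‖ξ‖ : ℝ) *
      (F ξ / (2 * Real.pi * Complex.I * (‖ξ‖ : ℝ)))) =ᵐ[volume] F := by
  have : Nontrivial (E n) := Module.nontrivial_of_finrank_pos (R := ℝ) (by simp; omega)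
  filter_upwards [compl_mem_ae_iff.2 (measure_singleton (0 : E n))] with ξ hξ
  have h1 : ((‖ξ‖ : ℝ) : ℂ) ≠ 0 := by simpa using hξ
  have h2 : (Real.pi : ℂ) ≠ 0 := by simp [Real.pi_ne_zero]
  have h3 := Complex.I_ne_zero
  field_simp

theorem hasDerivAt_sinWave {n : ℕ} (hn : 2 ≤ n) (F : 𝓢(E n, ℂ)) (x : E n) (t : ℝ) :
    HasDerivAt (fun τ => sinWave F x τ) (cosWave F x t) t := by
  have ha := hasMoments_div_norm (V := E n) (by simpa using hn) (𝓕 F : 𝓢(E n, ℂ))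
  convert! ha.hasDerivAt_parityWave (-1) x t using 1
  have hw := norm_mul_div_norm_ae (show 1 ≤ n by omega) (𝓕 F : 𝓢(E n, ℂ))
  simp only [cosWave, parityWave, wave_congr_ae hw, neg_neg]

theorem isWaveSolution_sinWave {n : ℕ} (hn : 2 ≤ n) (F : 𝓢(E n, ℂ)) :
    IsWaveSolution (fun _ => 0) (fun x => (F x).re) (fun x t => (sinWave F x t).re) := by
  have ha := hasMoments_div_norm (V := E n) (by simpa using hn) (𝓕 F : 𝓢(E n, ℂ))
  have h := isWaveSolution_parityWave ha (-1)
  have e1 : ∀ x, parityWave (- -1) (fun ξ => 2 * Real.pi * Complex.I * (‖ξ‖ : ℝ) *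
      ((𝓕 F : 𝓢(E n, ℂ)) ξ / (2 * Real.pi * Complex.I * (‖ξ‖ : ℝ)))) x 0 = F x := fun x => by
    have hw := norm_mul_div_norm_ae (show 1 ≤ n by omega) (𝓕 F : 𝓢(E n, ℂ))
    simp only [parityWave, wave_congr_ae hw, neg_zero, wave_fourier_zero]
    simp
  have e2 : ∀ x, parityWave (-1) (fun ξ => ((𝓕 F : 𝓢(E n, ℂ)) ξ /
      (2 * Real.pi * Complex.I * (‖ξ‖ : ℝ)))) x 0 = 0 := fun x => by
    simp [parityWave]
  simp only [e1, e2, Complex.zero_re] at h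
  exact h

/-! ### Gaussian averages in time. -/

section Gaussian

theorem continuous_wave {n : ℕ} {a : E n → ℂ} (ha : HasMoments a) (x : E n) :
    Continuous (fun t => wave a x t) :=
  continuous_iff_continuousAt.2 fun t => (ha.hasDerivAt_wave_time x t).continuousAt

theorem norm_cexp_neg_mul_sq (μ : ℂ) (t : ℝ) : ‖Complex.exp (-μ * t ^ 2)‖ = Real.exp (-μ.re * t ^ 2) := by
  rw [Complex.norm_exp]
  congr 1
  rw [← Complex.ofReal_pow, Complex.re_mul_ofReal, Complex.neg_re]

theorem integrable_cexp_neg_mul_sq' {μ : ℂ} (hμ : 0 < μ.re) :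
    Integrable fun t : ℝ => Complex.exp (-μ * t ^ 2) := by
  simpa using GaussianFourier.integrable_cexp_neg_mul_sq_add_real_mul_I hμ 0

/-- The Gaussian average in time of a superposition of plane waves. -/
theorem integral_wave_mul_gaussian {n : ℕ} {a : E n → ℂ} (ha : HasMoments a) (x : E n) {μ : ℂ}
    (hμ : 0 < μ.re) :
    ∫ t : ℝ, wave a x t * Complex.exp (-μ * t ^ 2) = (Real.pi / μ) ^ (1 / 2 : ℂ) *
      ∫ ξ, a ξ * Complex.exp (-(Real.pi ^ 2 / μ) * ‖ξ‖ ^ 2 + 2 * Real.pi * Complex.I * (inner ℝ x ξ : ℝ)) := by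
  have hm := ha.measurable
  have hint : Integrable (Function.uncurry fun (t : ℝ) (ξ : E n) =>
      ((Real.fourierChar (inner ℝ ξ x + ‖ξ‖ * t) : Circle) : ℂ) * a ξ * Complex.exp (-μ * t ^ 2))
      (volume.prod volume) := by
    have h1 : Integrable (fun p : ℝ × E n => Complex.exp (-μ * p.1 ^ 2) * a p.2) (volume.prod volume) :=
      (integrable_cexp_neg_mul_sq' hμ).mul_prod ha.integrable_self
    refine h1.mono (Measurable.aestronglyMeasurable ?_) (.of_forall fun p => ?_)
    · simp only [Function.uncurry_def]
      fun_prop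
    · simp only [Function.uncurry_def, norm_mul, Circle.norm_coe, one_mul]
      rw [mul_comm]
  have h2 : ∀ t : ℝ, wave a x t * Complex.exp (-μ * t ^ 2) =
      ∫ ξ, ((Real.fourierChar (inner ℝ ξ x + ‖ξ‖ * t) : Circle) : ℂ) * a ξ *
        Complex.exp (-μ * t ^ 2) := fun t => (integral_mul_const _ _).symm
  simp only [h2]
  rw [integral_integral_swap hint, ← integral_const_mul]
  refine integral_congr_ae (.of_forall fun ξ => ?_)
  have h3 : ∀ t : ℝ, ((Real.fourierChar (inner ℝ ξ x + ‖ξ‖ * t) : Circle) : ℂ) * a ξ *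
      Complex.exp (-μ * t ^ 2) = (Complex.exp (2 * Real.pi * Complex.I * (inner ℝ x ξ : ℝ)) * a ξ) *
      (Complex.exp (Complex.I * (2 * Real.pi * ‖ξ‖ : ℂ) * t) * Complex.exp (-μ * t ^ 2)) := by
    intro t
    have : ((Real.fourierChar (inner ℝ ξ x + ‖ξ‖ * t) : Circle) : ℂ) =
        Complex.exp (2 * Real.pi * Complex.I * (inner ℝ x ξ : ℝ)) *
          Complex.exp (Complex.I * (2 * Real.pi * ‖ξ‖ : ℂ) * t) := by
      rw [Real.fourierChar_apply, ← Complex.exp_add, real_inner_comm]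
      congr 1
      push_cast
      ring
    rw [this]
    ring
  simp only [h3]
  rw [integral_const_mul, fourierIntegral_gaussian hμ]
  have hμ0 : μ ≠ 0 := by
    rintro rfl
    simp at hμ
  have h4 : Complex.exp (-(2 * Real.pi * ‖ξ‖ : ℂ) ^ 2 / (4 * μ)) =
      Complex.exp (-(Real.pi ^ 2 / μ) * ‖ξ‖ ^ 2) := by
    congr 1
    field_simp
    ring
  rw [h4, Complex.exp_add]
  ring

/-- Here odd dimension enters: the one-dimensional Gaussian integral in time and the n-dimensional
one in frequency leave an integer power of μ. The half-plane Re z > 0 avoids the branch cut. -/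
theorem cpow_half_mul_cpow {n m : ℕ} (hnm : n = 2 * m + 1) {z : ℂ} (hz : 0 < z.re) :
    z⁻¹ ^ (1 / 2 : ℂ) * z ^ (n / 2 : ℂ) = z ^ m := by
  have h0 : z ≠ 0 := by
    rintro rfl
    simp at hz
  have harg : z.arg ≠ Real.pi := by
    intro h
    have := (Complex.arg_eq_pi_iff.1 h).1
    linarith
  have h1 : z ^ (1 / 2 : ℂ) ≠ 0 := by simp [Complex.cpow_eq_zero_iff, h0]
  have h2 : (n / 2 : ℂ) = 1 / 2 + m := by
    rw [hnm]
    push_cast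
    ring
  rw [Complex.inv_cpow _ _ harg, h2, Complex.cpow_add _ _ h0, Complex.cpow_natCast, ← mul_assoc,
    inv_mul_cancel₀ h1, one_mul]

/-- An even weight in t does not distinguish the cosine solution from the full wave. The time
integral produces a Gaussian in |ξ|, and the multiplication formula moves the Fourier transform from
F onto it, giving a Gaussian in |x - y|. -/
theorem integral_cosWave_mul_gaussian {n m : ℕ} (hnm : n = 2 * m + 1) (F : 𝓢(E n, ℂ)) (x : E n)
    {μ : ℂ} (hμ : 0 < μ.re) :
    ∫ t : ℝ, cosWave F x t * Complex.exp (-μ * t ^ 2) =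
      (μ / Real.pi) ^ m * ∫ y, F y * Complex.exp (-μ * ‖x - y‖ ^ 2) := by
  have ha := hasMoments_schwartz (𝓕 F : 𝓢(E n, ℂ))
  have hw : Integrable fun t : ℝ => wave (𝓕 F : 𝓢(E n, ℂ)) x t * Complex.exp (-μ * t ^ 2) := by
    refine (integrable_cexp_neg_mul_sq' hμ).bdd_mul (continuous_wave ha x).aestronglyMeasurable
      (.of_forall fun t => norm_wave_le _ _ _)
  have h1 : ∫ t : ℝ, cosWave F x t * Complex.exp (-μ * t ^ 2) =
      ∫ t : ℝ, wave (𝓕 F : 𝓢(E n, ℂ)) x t * Complex.exp (-μ * t ^ 2) := by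
    have h2 := integral_neg_eq_self
      (fun t : ℝ => wave (𝓕 F : 𝓢(E n, ℂ)) x t * Complex.exp (-μ * t ^ 2)) volume
    have h3 : ∀ t : ℝ, cosWave F x t * Complex.exp (-μ * t ^ 2) =
        (1 / 2) * (wave (𝓕 F : 𝓢(E n, ℂ)) x t * Complex.exp (-μ * t ^ 2)) +
        (1 / 2) * (wave (𝓕 F : 𝓢(E n, ℂ)) x (-t) * Complex.exp (-μ * ((-t : ℝ) : ℂ) ^ 2)) := by
      intro t
      simp only [cosWave, parityWave, Complex.ofReal_neg, Complex.ofReal_one, one_mul, neg_sq]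
      ring
    simp only [h3]
    rw [integral_add (hw.const_mul _) (hw.comp_neg.const_mul _), integral_const_mul,
      integral_const_mul, h2]
    ring
  have hμ0 : μ ≠ 0 := by
    rintro rfl
    simp at hμ
  have hpi : (Real.pi : ℂ) ≠ 0 := by simp [Real.pi_ne_zero]
  have hb : 0 < (Real.pi ^ 2 / μ : ℂ).re := by
    rw [← Complex.ofReal_pow, div_eq_mul_inv, Complex.re_ofReal_mul, Complex.inv_re]
    have : 0 < Complex.normSq μ := Complex.normSq_pos.2 hμ0
    have := Real.pi_pos
    positivity
  let g : E n → ℂ := fun ξ =>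
    Complex.exp (-(Real.pi ^ 2 / μ) * ‖ξ‖ ^ 2 + 2 * Real.pi * Complex.I * (inner ℝ x ξ : ℝ))
  have hg : Integrable g := GaussianFourier.integrable_cexp_neg_mul_sq_norm_add hb _ x
  have h4 := VectorFourier.integral_fourierIntegral_smul_eq_flip (μ := (volume : Measure (E n)))
    (ν := (volume : Measure (E n))) (L := innerₗ (E n)) (f := F) (g := g)
    Real.continuous_fourierChar continuous_inner F.integrable hg
  have h5 : ∀ y, VectorFourier.fourierIntegral Real.fourierChar volume (innerₗ (E n)).flip g y =
      (μ / Real.pi) ^ (n / 2 : ℂ) * Complex.exp (-μ * ‖x - y‖ ^ 2) := by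
    intro y
    rw [flip_innerₗ]
    change 𝓕 g y = _
    rw [fourier_gaussian_innerProductSpace' hb x y]
    have e1 : (Real.pi / (Real.pi ^ 2 / μ) : ℂ) = μ / Real.pi := by field_simp
    have e2 : (-Real.pi ^ 2 * ‖x - y‖ ^ 2 / (Real.pi ^ 2 / μ) : ℂ) = -μ * ‖x - y‖ ^ 2 := by
      field_simp
    rw [e1, e2]
    simp
  have h6 : ∀ ξ, VectorFourier.fourierIntegral Real.fourierChar volume (innerₗ (E n)) F ξ =
      (𝓕 F : 𝓢(E n, ℂ)) ξ := fun ξ => by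
    rw [fourier_coe]
    rfl
  simp only [h5, h6, smul_eq_mul] at h4
  rw [h1, integral_wave_mul_gaussian ha x hμ, h4]
  have h7 : ∀ y, F y * ((μ / Real.pi) ^ (n / 2 : ℂ) * Complex.exp (-μ * ‖x - y‖ ^ 2)) =
      (μ / Real.pi) ^ (n / 2 : ℂ) * (F y * Complex.exp (-μ * ‖x - y‖ ^ 2)) := fun y => by ring
  simp only [h7]
  rw [integral_const_mul, ← mul_assoc, ← cpow_half_mul_cpow hnm (z := μ / Real.pi), inv_div]
  rw [Complex.div_ofReal_re]
  exact div_pos hμ Real.pi_pos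

end Gaussian

/-! ### From Gaussians to arbitrary test functions of t². -/

section Weak

/-- The function `σ ↦ exp σ * φ σ` as a complex Schwartz function. -/
def expMul (φ : ℝ → ℝ) (hφ : ContDiff ℝ ∞ φ) (hc : HasCompactSupport φ) : 𝓢(ℝ, ℂ) :=
  HasCompactSupport.toSchwartzMap (f := fun σ => ((Real.exp σ * φ σ : ℝ) : ℂ))
    (hc.mul_left (f := Real.exp)|>.comp_left (g := fun r : ℝ => (r : ℂ)) Complex.ofReal_zero)
    (Complex.ofRealCLM.contDiff.comp (Real.contDiff_exp.mul hφ))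

theorem expMul_apply (φ : ℝ → ℝ) (hφ : ContDiff ℝ ∞ φ) (hc : HasCompactSupport φ) (σ : ℝ) :
    expMul φ hφ hc σ = ((Real.exp σ * φ σ : ℝ) : ℂ) := rfl

theorem contDiff_deriv_infty {φ : ℝ → ℝ} (hφ : ContDiff ℝ ∞ φ) : ContDiff ℝ ∞ (deriv φ) :=
  (contDiff_infty_iff_deriv.1 hφ).2

/-- With the weight exp σ, Fourier inversion writes φ as a superposition of exp(-μσ) over the line μ
= 1 - 2πir, where Re μ = 1. On this side -d/dσ is multiplication by μ, which explains how powers of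
μ become derivatives. -/
theorem fourier_expMul_neg_deriv (φ : ℝ → ℝ) (hφ : ContDiff ℝ ∞ φ) (hc : HasCompactSupport φ)
    (r : ℝ) :
    𝓕 (expMul (fun σ => -deriv φ σ) (contDiff_deriv_infty hφ).neg hc.deriv.neg) r =
      (1 - 2 * Real.pi * Complex.I * r) * 𝓕 (expMul φ hφ hc) r := by
  set χ := expMul φ hφ hc with hχ
  have hd : ∀ σ, HasDerivAt χ (((Real.exp σ * φ σ + Real.exp σ * deriv φ σ : ℝ) : ℂ)) σ := by
    intro σ
    have h1 : HasDerivAt φ (deriv φ σ) σ := (hφ.differentiable (by simp) σ).hasDerivAt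
    exact ((Real.hasDerivAt_exp σ).mul h1).ofReal_comp
  have e : expMul (fun σ => -deriv φ σ) (contDiff_deriv_infty hφ).neg hc.deriv.neg =
      χ - derivCLM ℂ ℂ χ := by
    ext σ
    rw [sub_apply, derivCLM_apply, (hd σ).deriv, hχ, expMul_apply, expMul_apply]
    push_cast
    ring
  have h2 : 𝓕 (derivCLM ℂ ℂ χ) r = 2 * Real.pi * Complex.I * r * 𝓕 χ r := by
    have := congrFun (Real.fourier_deriv χ.integrable χ.differentiable
      (derivCLM ℂ ℂ χ).integrable) r
    rw [fourier_coe, fourier_coe]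
    exact this
  rw [e, sub_eq_add_neg, FourierTransform.fourier_add, FourierTransform.fourier_neg,
    add_apply, neg_apply, h2]
  ring

/-- Derivatives of a test function as superpositions of exponentials. -/
theorem iteratedDeriv_eq_integral_cexp (k : ℕ) (φ : ℝ → ℝ) (hφ : ContDiff ℝ ∞ φ)
    (hc : HasCompactSupport φ) (σ : ℝ) :
    ((((-1) ^ k * iteratedDeriv k φ σ : ℝ)) : ℂ) = ∫ r : ℝ, 𝓕 (expMul φ hφ hc) r *
      (1 - 2 * Real.pi * Complex.I * r) ^ k * Complex.exp (-(1 - 2 * Real.pi * Complex.I * r) * σ) := by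
  induction k generalizing φ with
  | zero =>
    have h1 : 𝓕⁻ (𝓕 (expMul φ hφ hc)) σ = expMul φ hφ hc σ := by simp
    have h2 : (φ σ : ℂ) = Complex.exp (-σ) * 𝓕⁻ (𝓕 (expMul φ hφ hc)) σ := by
      rw [h1, expMul_apply, Complex.ofReal_mul, ← mul_assoc, Complex.ofReal_exp, ← Complex.exp_add]
      simp
    rw [pow_zero, one_mul, iteratedDeriv_zero, h2, fourierInv_coe, Real.fourierInv_eq,
      ← integral_const_mul]
    refine integral_congr_ae (.of_forall fun r => ?_)
    have h3 : Complex.exp (-(1 - 2 * Real.pi * Complex.I * r) * σ) =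
        Complex.exp (-σ) * ((Real.fourierChar (inner ℝ r σ) : Circle) : ℂ) := by
      rw [Real.fourierChar_apply, ← Complex.exp_add]
      congr 1
      simp
      ring
    simp only [h3, Circle.smul_def, smul_eq_mul]
    ring
  | succ k ih =>
    have h := ih (fun σ => -deriv φ σ) (contDiff_deriv_infty hφ).neg hc.deriv.neg
    have e : (-1) ^ (k + 1) * iteratedDeriv (k + 1) φ σ =
        (-1) ^ k * iteratedDeriv k (fun σ => -deriv φ σ) σ := by
      rw [iteratedDeriv_succ']
      have := iteratedDeriv_neg k (deriv φ) σ
      simp only [Pi.neg_def] at this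
      rw [this]
      ring
    rw [e, h]
    refine integral_congr_ae (.of_forall fun r => ?_)
    have h1 := fourier_expMul_neg_deriv φ hφ hc r
    simp only at h1 ⊢
    rw [h1]
    ring

theorem norm_cexp_line (r σ : ℝ) :
    ‖Complex.exp (-(1 - 2 * Real.pi * Complex.I * r) * σ)‖ = Real.exp (-σ) := by
  rw [Complex.norm_exp]
  simp

/-- An identity between Gaussian averages extends from Gaussians to all test functions. -/
theorem integral_mul_comp_sq_of_gaussian {n : ℕ} {w : ℝ → ℂ} (hw : Continuous w) {B : ℝ}
    (hB : ∀ t, ‖w t‖ ≤ B * (1 + |t|)) {F : E n → ℂ} (hF : Integrable F) (x : E n) (k : ℕ) (C : ℂ)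
    (h : ∀ μ : ℂ, 0 < μ.re → ∫ t : ℝ, w t * Complex.exp (-μ * t ^ 2) =
      C * μ ^ k * ∫ y, F y * Complex.exp (-μ * ‖x - y‖ ^ 2))
    {φ : ℝ → ℝ} (hφ : ContDiff ℝ ∞ φ) (hc : HasCompactSupport φ) :
    ∫ t : ℝ, w t * φ (t ^ 2) =
      C * (-1) ^ k * ∫ y, F y * (iteratedDeriv k φ (‖x - y‖ ^ 2) : ℝ) := by
  let c : 𝓢(ℝ, ℂ) := 𝓕 (expMul φ hφ hc)
  let l : ℝ → ℂ := fun r => 1 - 2 * Real.pi * Complex.I * r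
  have hl : ∀ r, 0 < (l r).re := fun r => by simp [l]
  have hlc : Continuous l := by fun_prop
  have hcc : Continuous c := c.continuous
  have e0 : ∀ t : ℝ, w t * φ (t ^ 2) = ∫ r : ℝ, w t * (c r * Complex.exp (-l r * t ^ 2)) := by
    intro t
    have := iteratedDeriv_eq_integral_cexp 0 φ hφ hc (t ^ 2)
    simp only [pow_zero, one_mul, iteratedDeriv_zero, mul_one] at this
    rw [this, ← integral_const_mul]
    simp [c, l]
  -- On the line Re μ = 1 every Gaussian has modulus exp(-t²), which beats the linear growth allowed
  -- for w. That growth is needed for t times the sine solution.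
  have i0 : Integrable (Function.uncurry fun (t r : ℝ) => w t * (c r * Complex.exp (-l r * t ^ 2)))
      (volume.prod volume) := by
    have h1 : Integrable fun t : ℝ => B * (1 + |t|) * Real.exp (-1 * t ^ 2) := by
      have h2 := (integrable_exp_neg_mul_sq (b := 1) one_pos)
      have h3 := (integrable_mul_exp_neg_mul_sq (b := 1) one_pos).norm
      refine ((h2.add h3).const_mul B).congr (.of_forall fun t => ?_)
      simp
      ring
    have h2 := h1.mul_prod (c.integrable (μ := volume)).norm
    refine h2.mono' (Continuous.aestronglyMeasurable (by fun_prop)) (.of_forall fun p => ?_)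
    rcases p with ⟨t, r⟩
    have h3 : ‖Complex.exp (-l r * t ^ 2)‖ = Real.exp (-1 * t ^ 2) := by
      have := norm_cexp_line r (t ^ 2)
      push_cast at this
      rw [this]
      simp
    simp only [Function.uncurry_apply_pair, norm_mul, h3]
    calc ‖w t‖ * (‖c r‖ * Real.exp (-1 * t ^ 2))
        ≤ (B * (1 + |t|)) * (‖c r‖ * Real.exp (-1 * t ^ 2)) := by
          gcongr
          exact hB t
      _ = _ := by ring
  have e1 : ∀ r : ℝ, ∫ t : ℝ, w t * (c r * Complex.exp (-l r * t ^ 2)) =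
      ∫ y, C * (F y * (c r * l r ^ k * Complex.exp (-l r * ‖x - y‖ ^ 2))) := by
    intro r
    have : ∀ t : ℝ, w t * (c r * Complex.exp (-l r * t ^ 2)) = c r * (w t * Complex.exp (-l r * t ^ 2)) :=
      fun t => by ring
    simp only [this]
    rw [integral_const_mul, h _ (hl r), ← integral_const_mul, ← integral_const_mul]
    refine integral_congr_ae (.of_forall fun y => ?_)
    ring
  have i1 : Integrable (Function.uncurry fun (r : ℝ) (y : E n) =>
      C * (F y * (c r * l r ^ k * Complex.exp (-l r * ‖x - y‖ ^ 2)))) (volume.prod volume) := by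
    -- The factor μ^k grows polynomially in r and is absorbed by the Schwartz decay of c.
    have hck : Integrable fun r => c r * l r ^ k := by
      have hb : ∀ r, ‖l r‖ ≤ (1 + 2 * Real.pi) * (1 + ‖r‖) := by
        intro r
        refine (norm_sub_le _ _).trans ?_
        have hpi := Real.pi_pos
        simp only [norm_one, norm_mul, Complex.norm_ofNat, Complex.norm_real, Complex.norm_I,
          Real.norm_eq_abs, abs_of_pos hpi, mul_one]
        nlinarith [abs_nonneg r]
      have h1 : Integrable fun r : ℝ => (1 + ‖r‖) ^ k * ‖c r‖ := by
        have h2 : Integrable fun r : ℝ => ∑ j ∈ Finset.range (k + 1),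
            (k.choose j : ℝ) * (‖r‖ ^ j * ‖c r‖) :=
          integrable_finsetSum _ fun j _ => (c.integrable_pow_mul volume j).const_mul _
        refine h2.congr (.of_forall fun r => ?_)
        simp only [add_comm (1 : ℝ), add_pow, one_pow, mul_one]
        rw [Finset.sum_mul]
        exact Finset.sum_congr rfl fun j _ => by ring
      refine (h1.const_mul ((1 + 2 * Real.pi) ^ k)).mono'
        (Continuous.aestronglyMeasurable (by fun_prop)) (.of_forall fun r => ?_)
      rw [norm_mul, norm_pow]
      calc ‖c r‖ * ‖l r‖ ^ k ≤ ‖c r‖ * ((1 + 2 * Real.pi) * (1 + ‖r‖)) ^ k := by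
            gcongr
            exact hb r
        _ = _ := by
            rw [mul_pow]
            ring
    have h1 := hck.mul_prod (hF.const_mul C)
    refine h1.mono ?_ (.of_forall fun p => ?_)
    · have a1 : AEStronglyMeasurable (fun p : ℝ × E n => F p.2) (volume.prod volume) :=
        hF.aestronglyMeasurable.comp_snd
      have a2 : Continuous fun p : ℝ × E n => c p.1 * l p.1 ^ k * Complex.exp (-l p.1 * ‖x - p.2‖ ^ 2) := by
        fun_prop
      exact (a1.mul a2.aestronglyMeasurable).const_mul C
    · rcases p with ⟨r, y⟩
      have h3 : ‖Complex.exp (-l r * ‖x - y‖ ^ 2)‖ ≤ 1 := by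
        have := norm_cexp_line r (‖x - y‖ ^ 2)
        push_cast at this
        rw [this, Real.exp_le_one_iff]
        exact neg_nonpos.2 (sq_nonneg _)
      simp only [Function.uncurry_apply_pair, norm_mul]
      calc ‖C‖ * (‖F y‖ * (‖c r‖ * ‖l r ^ k‖ * ‖Complex.exp (-l r * ‖x - y‖ ^ 2)‖))
          ≤ ‖C‖ * (‖F y‖ * (‖c r‖ * ‖l r ^ k‖ * 1)) := by gcongr
        _ = _ := by ring
  simp only [e0]
  rw [integral_integral_swap i0]
  simp only [e1]
  rw [integral_integral_swap i1, ← integral_const_mul]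
  refine integral_congr_ae (.of_forall fun y => ?_)
  have := iteratedDeriv_eq_integral_cexp k φ hφ hc (‖x - y‖ ^ 2)
  simp only
  rw [integral_const_mul, integral_const_mul]
  have h1 : ∫ r : ℝ, c r * l r ^ k * Complex.exp (-l r * ‖x - y‖ ^ 2) =
      (((-1) ^ k * iteratedDeriv k φ (‖x - y‖ ^ 2) : ℝ) : ℂ) := by
    rw [this]
    simp [c, l]
  rw [h1]
  push_cast
  ring

end Weak

/-! ### The weak representation formula and finite speed of propagation. -/

section ConeMean

/-- A family of even functions of time whose averages against functions of `t ^ 2` are given by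
averages of `F` against derivatives of functions of `‖x - y‖ ^ 2`. -/
structure IsConeMean {n : ℕ} (k : ℕ) (C : ℂ) (F : E n → ℂ) (w : E n → ℝ → ℂ) : Prop where
  cont : Continuous fun p : E n × ℝ => w p.1 p.2
  even : ∀ x t, w x (-t) = w x t
  weak : ∀ (x : E n) (φ : ℝ → ℝ), ContDiff ℝ ∞ φ → HasCompactSupport φ →
    ∫ t : ℝ, w x t * φ (t ^ 2) =
      C * (-1) ^ k * ∫ y, F y * (iteratedDeriv k φ (‖x - y‖ ^ 2) : ℝ)

theorem isConeMean_cosWave {n m : ℕ} (hnm : n = 2 * m + 1) (F : 𝓢(E n, ℂ)) :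
    IsConeMean m (1 / Real.pi ^ m) F (cosWave F) := by
  have ha := hasMoments_schwartz (𝓕 F : 𝓢(E n, ℂ))
  have hcont : Continuous fun p : E n × ℝ => cosWave F p.1 p.2 :=
    (ha.contDiff_parityWave 1).continuous
  refine ⟨hcont, fun x t => ?_, fun x φ hφ hc => ?_⟩
  · simp only [cosWave, parityWave, neg_neg]
    push_cast
    ring
  · refine integral_mul_comp_sq_of_gaussian (B := ∫ ξ, ‖(𝓕 F : 𝓢(E n, ℂ)) ξ‖)
      (by fun_prop) (fun t => ?_) F.integrable x m _ (fun μ hμ => ?_) hφ hc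
    · have h0 : 0 ≤ ∫ ξ, ‖(𝓕 F : 𝓢(E n, ℂ)) ξ‖ := integral_nonneg fun _ => norm_nonneg _
      have h1 := norm_wave_le (𝓕 F : 𝓢(E n, ℂ)) x t
      have h2 := norm_wave_le (𝓕 F : 𝓢(E n, ℂ)) x (-t)
      have h3 : ‖cosWave F x t‖ ≤ ∫ ξ, ‖(𝓕 F : 𝓢(E n, ℂ)) ξ‖ := by
        rw [cosWave, parityWave, norm_div, Complex.norm_ofNat, div_le_iff₀ two_pos]
        refine (norm_add_le _ _).trans ?_
        simp only [Complex.ofReal_one, one_mul]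
        linarith
      nlinarith [abs_nonneg t]
    · rw [integral_cosWave_mul_gaussian hnm F x hμ, div_pow]
      ring

theorem norm_sinWave_le {n : ℕ} (F : 𝓢(E n, ℂ)) (x : E n) (t : ℝ) : ‖sinWave F x t‖ ≤
    ∫ ξ, ‖(𝓕 F : 𝓢(E n, ℂ)) ξ / (2 * Real.pi * Complex.I * (‖ξ‖ : ℝ))‖ := by
  set b : E n → ℂ := fun ξ => (𝓕 F : 𝓢(E n, ℂ)) ξ / (2 * Real.pi * Complex.I * (‖ξ‖ : ℝ))
  have h1 := norm_wave_le b x t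
  have h2 := norm_wave_le b x (-t)
  rw [sinWave, parityWave, norm_div, Complex.norm_ofNat, div_le_iff₀ two_pos]
  refine (norm_add_le _ _).trans ?_
  rw [norm_mul, Complex.norm_real, norm_neg, norm_one, one_mul]
  linarith

/-- The factor t makes the odd solution even. Since the sine solution has the cosine solution as
time derivative, integration by parts against t exp(-μt²) costs 1/(2μ): this lowers the order from m
to m - 1 and halves the constant. -/
theorem isConeMean_sinWave {n m : ℕ} (hm : 1 ≤ m) (hnm : n = 2 * m + 1) (F : 𝓢(E n, ℂ)) :
    IsConeMean (m - 1) (1 / (2 * Real.pi ^ m)) F (fun x t => t * sinWave F x t) := by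
  have ha := hasMoments_div_norm (V := E n) (by simp; omega) (𝓕 F : 𝓢(E n, ℂ))
  have hcont : Continuous fun p : E n × ℝ => sinWave F p.1 p.2 :=
    (ha.contDiff_parityWave (-1)).continuous
  have hcos : Continuous fun p : E n × ℝ => cosWave F p.1 p.2 :=
    (isConeMean_cosWave hnm F).cont
  set B := ∫ ξ, ‖(𝓕 F : 𝓢(E n, ℂ)) ξ / (2 * Real.pi * Complex.I * (‖ξ‖ : ℝ))‖ with hBdef
  have h0 : 0 ≤ B := integral_nonneg fun _ => norm_nonneg _
  refine ⟨by fun_prop, fun x t => ?_, fun x φ hφ hc => ?_⟩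
  · simp only [sinWave, parityWave, neg_neg]
    push_cast
    ring
  · refine integral_mul_comp_sq_of_gaussian (B := B) (by fun_prop) (fun t => ?_) F.integrable
      x (m - 1) _ (fun μ hμ => ?_) hφ hc
    · have h3 := norm_sinWave_le F x t
      rw [norm_mul, Complex.norm_real, Real.norm_eq_abs]
      nlinarith [abs_nonneg t, norm_nonneg (sinWave F x t)]
    · have hμ0 : μ ≠ 0 := by
        rintro rfl
        simp at hμ
      have hg : ∀ t : ℝ, HasDerivAt (fun t : ℝ => Complex.exp (-μ * t ^ 2))
          (Complex.exp (-μ * t ^ 2) * (-μ * (2 * t))) t := by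
        intro t
        have h1 : HasDerivAt (fun t : ℝ => ((t : ℝ) : ℂ)) 1 t := Complex.ofRealCLM.hasDerivAt
        convert! ((h1.pow 2).const_mul (-μ)).cexp using 1
        simp
      have ig := integrable_cexp_neg_mul_sq' hμ
      have itg : Integrable fun t : ℝ => (t : ℂ) * Complex.exp (-μ * t ^ 2) := by
        refine ((integrable_mul_exp_neg_mul_sq hμ).norm).mono'
          (Continuous.aestronglyMeasurable (by fun_prop)) (.of_forall fun t => ?_)
        rw [norm_mul, norm_mul, norm_cexp_neg_mul_sq, Complex.norm_real,
          Real.norm_of_nonneg (Real.exp_nonneg _)]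
      have hsx : Continuous fun t => sinWave F x t := by fun_prop
      have hcx : Continuous fun t => cosWave F x t := by fun_prop
      obtain ⟨B', hB'⟩ : ∃ B', ∀ t, ‖cosWave F x t‖ ≤ B' := by
        refine ⟨∫ ξ, ‖(𝓕 F : 𝓢(E n, ℂ)) ξ‖, fun t => ?_⟩
        have h1 := norm_wave_le (𝓕 F : 𝓢(E n, ℂ)) x t
        have h2 := norm_wave_le (𝓕 F : 𝓢(E n, ℂ)) x (-t)
        rw [cosWave, parityWave, norm_div, Complex.norm_ofNat, div_le_iff₀ two_pos]
        refine (norm_add_le _ _).trans ?_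
        simp only [Complex.ofReal_one, one_mul]
        linarith
      have i1 : Integrable ((fun t => sinWave F x t) *
          fun t : ℝ => Complex.exp (-μ * t ^ 2) * (-μ * (2 * t))) := by
        refine ((itg.const_mul (-2 * μ)).bdd_mul hsx.aestronglyMeasurable
          (.of_forall (norm_sinWave_le F x))).congr (.of_forall fun t => ?_)
        simp only [Pi.mul_apply]
        ring
      have i2 : Integrable ((fun t => cosWave F x t) * fun t : ℝ => Complex.exp (-μ * t ^ 2)) :=
        ig.bdd_mul hcx.aestronglyMeasurable (.of_forall hB')
      have i3 : Integrable ((fun t => sinWave F x t) * fun t : ℝ => Complex.exp (-μ * t ^ 2)) :=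
        ig.bdd_mul hsx.aestronglyMeasurable (.of_forall (norm_sinWave_le F x))
      have key := integral_mul_deriv_eq_deriv_mul_of_integrable
        (fun t _ => hasDerivAt_sinWave (by omega) F x t) (fun t _ => hg t) i1 i2 i3
      rw [integral_cosWave_mul_gaussian hnm F x hμ] at key
      have h4 : ∀ t : ℝ, (t : ℂ) * sinWave F x t * Complex.exp (-μ * t ^ 2) =
          (-(1 / (2 * μ))) *
            (sinWave F x t * (Complex.exp (-μ * t ^ 2) * (-μ * (2 * t)))) := by
        intro t
        field_simp
      simp only [h4]
      rw [integral_const_mul, key, div_pow]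
      obtain ⟨j, rfl⟩ : ∃ j, m = j + 1 := ⟨m - 1, by omega⟩
      have hpi : (Real.pi : ℂ) ≠ 0 := by simp [Real.pi_ne_zero]
      simp only [Nat.add_sub_cancel]
      field_simp
      ring

variable {n k : ℕ} {C : ℂ} {F : E n → ℂ} {w : E n → ℝ → ℂ}

theorem integral_even {f : ℝ → ℂ} (hf : Integrable f) (heven : ∀ t, f (-t) = f t) :
    ∫ t, f t = 2 * ∫ t in Ioi (0 : ℝ), f t := by
  have h1 := integral_comp_neg_Ioi (0 : ℝ) f
  simp only [heven, neg_zero] at h1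
  rw [← integral_add_compl (s := Ioi (0 : ℝ)) measurableSet_Ioi hf, compl_Ioi, ← h1]
  ring

/-- Turns a test function of t > 0 into one of σ = t²; vanishing below δ removes the singularity of
the square root. -/
theorem contDiff_comp_sqrt {g : ℝ → ℝ} (hg : ContDiff ℝ ∞ g) {δ : ℝ} (hδ : 0 < δ)
    (h0 : ∀ t < δ, g t = 0) : ContDiff ℝ ∞ fun σ => g (Real.sqrt σ) := by
  rw [contDiff_iff_contDiffAt]
  intro σ
  rcases lt_or_ge 0 σ with h | h
  · exact hg.contDiffAt.comp σ (Real.contDiffAt_sqrt h.ne')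
  · have : (fun σ => g (Real.sqrt σ)) =ᶠ[nhds σ] fun _ => 0 := by
      filter_upwards [Iio_mem_nhds (show σ < δ ^ 2 by nlinarith)] with τ hτ
      exact h0 _ ((Real.sqrt_lt' hδ).2 hτ)
    exact contDiffAt_const.congr_of_eventuallyEq this

/-- Finite speed of propagation. -/
theorem IsConeMean.eq_zero (h : IsConeMean k C F w) {R : ℝ} (hF : ∀ y, R < ‖y‖ → F y = 0)
    {x : E n} {t : ℝ} (ht : |t| < ‖x‖ - R) : w x t = 0 := by
  set ρ := ‖x‖ - R with hρ
  have hρ0 : 0 < ρ := (abs_nonneg t).trans_lt ht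
  have hcx : Continuous fun t => w x t := by
    have := h.cont
    fun_prop
  -- Each test function g on (0, ρ) is fed into the weak formula as φ(σ) = g(√σ).
  have hae : ∀ᵐ τ : ℝ, τ ∈ Ioo 0 ρ → w x τ = 0 := by
    refine isOpen_Ioo.ae_eq_zero_of_integral_contDiff_smul_eq_zero
      (hcx.locallyIntegrable.locallyIntegrableOn _) fun g hg hgc hgs => ?_
    have hg0 : ∀ τ, τ ∉ Ioo 0 ρ → g τ = 0 := fun τ hτ => image_eq_zero_of_notMem_tsupport
      fun h' => hτ (hgs h')
    obtain ⟨δ, hδ, hgδ⟩ : ∃ δ > 0, ∀ τ < δ, g τ = 0 := by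
      have : (0 : ℝ) ∉ tsupport g := fun h' => lt_irrefl _ (hgs h').1
      have hz : g =ᶠ[nhds 0] 0 := notMem_tsupport_iff_eventuallyEq.1 this
      obtain ⟨δ, hδ, hb⟩ := Metric.eventually_nhds_iff.1 hz
      refine ⟨δ, hδ, fun τ hτ => ?_⟩
      rcases lt_or_ge 0 τ with h1 | h1
      · exact hb (by rwa [Real.dist_eq, sub_zero, abs_of_pos h1])
      · exact hg0 τ fun h2 => not_lt.2 h1 h2.1
    have hφ := contDiff_comp_sqrt hg hδ hgδ
    have hφ0 : ∀ σ, ρ ^ 2 ≤ σ → g (Real.sqrt σ) = 0 := fun σ hσ => hg0 _ fun h2 =>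
      not_lt.2 (Real.le_sqrt_of_sq_le hσ) h2.2
    have hφc : HasCompactSupport fun σ => g (Real.sqrt σ) := by
      refine HasCompactSupport.intro (isCompact_Icc (a := 0) (b := ρ ^ 2)) fun σ hσ => ?_
      rcases lt_or_ge σ 0 with h1 | h1
      · rw [Real.sqrt_eq_zero_of_nonpos h1.le]
        exact hgδ 0 hδ
      · exact hφ0 σ (not_lt.1 fun h2 => hσ ⟨h1, h2.le⟩)
    have key := h.weak x _ hφ hφc
    -- Where F may be nonzero, |x - y| ≥ ρ. Since g vanishes from slightly below ρ onwards, φ is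
    -- zero in a neighbourhood of |x - y|², and so is its k-th derivative.
    have hr : ∀ y, F y * (iteratedDeriv k (fun σ => g (Real.sqrt σ)) (‖x - y‖ ^ 2) : ℝ) = 0 := by
      intro y
      rcases lt_or_ge R ‖y‖ with h1 | h1
      · rw [hF y h1, zero_mul]
      · obtain ⟨δ', hδ', hgδ'⟩ : ∃ δ' > 0, ∀ τ, ρ - δ' < τ → g τ = 0 := by
          have : ρ ∉ tsupport g := fun h' => lt_irrefl _ (hgs h').2
          have hz : g =ᶠ[nhds ρ] 0 := notMem_tsupport_iff_eventuallyEq.1 this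
          obtain ⟨δ', hδ', hb⟩ := Metric.eventually_nhds_iff.1 hz
          refine ⟨δ', hδ', fun τ hτ => ?_⟩
          rcases lt_or_ge τ ρ with h1 | h1
          · exact hb (by rw [Real.dist_eq, abs_lt]; constructor <;> linarith)
          · exact hg0 τ fun h2 => not_lt.2 h1 h2.2
        have h2 : ρ ≤ ‖x - y‖ := by
          have := norm_sub_norm_le x y
          linarith
        have h3 : (fun σ => g (Real.sqrt σ)) =ᶠ[nhds (‖x - y‖ ^ 2)] fun _ => 0 := by
          have hcs : Filter.Tendsto Real.sqrt (nhds (‖x - y‖ ^ 2)) (nhds ‖x - y‖) := by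
            have := Real.continuous_sqrt.tendsto (‖x - y‖ ^ 2)
            rwa [Real.sqrt_sq (norm_nonneg _)] at this
          filter_upwards [hcs.eventually (lt_mem_nhds (show ρ - δ' < ‖x - y‖ by linarith))]
            with σ hσ using hgδ' _ hσ
        rw [h3.iteratedDeriv_eq]
        simp
    simp only [hr, integral_zero, mul_zero, Real.sqrt_sq_eq_abs] at key
    have hgc' : Continuous fun τ => w x τ * (g |τ| : ℝ) := by
      have := hg.continuous
      fun_prop
    have hgi : Integrable fun τ => w x τ * (g |τ| : ℝ) := by
      refine hgc'.integrable_of_hasCompactSupport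
        (HasCompactSupport.intro (isCompact_Icc (a := -ρ) (b := ρ)) fun τ hτ => ?_)
      rw [hg0 |τ| fun h2 => hτ (abs_le.1 h2.2.le)]
      simp
    rw [integral_even hgi fun τ => by rw [h.even, abs_neg]] at key
    have h6 : ∫ τ in Ioi (0 : ℝ), w x τ * (g |τ| : ℝ) = ∫ τ, g τ • w x τ := by
      have h7 : ∫ τ in Ioi (0 : ℝ), g τ • w x τ = ∫ τ, g τ • w x τ :=
        setIntegral_eq_integral_of_forall_compl_eq_zero fun τ hτ => by
          rw [hg0 τ fun h2 => hτ h2.1, zero_smul]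
      rw [← h7]
      refine setIntegral_congr_fun measurableSet_Ioi fun τ hτ => ?_
      simp only [abs_of_pos (mem_Ioi.1 hτ), Complex.real_smul, mul_comm]
    rw [← h6]
    simpa using key
  -- Continuity upgrades the statement to every time and includes t = 0; evenness covers negative
  -- times.
  have hae' : w x =ᵐ[volume.restrict (Ico 0 ρ)] fun _ => 0 := by
    rw [← restrict_Ioo_eq_restrict_Ico]
    exact (ae_restrict_iff' measurableSet_Ioo).2 hae
  have hz := Measure.eqOn_Ico_of_ae_eq volume hae' hcx.continuousOn continuousOn_const
  have h7 : w x |t| = 0 := hz ⟨abs_nonneg t, ht⟩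
  rcases abs_choice t with h8 | h8
  · rwa [h8] at h7
  · rwa [h8, h.even] at h7

end ConeMean

/-! ### Uniqueness for the Cauchy problem by duality. -/

section Uniqueness

variable {n : ℕ}

/-- Green's second identity for a smooth function and a smooth compactly supported function. -/
theorem integral_laplacian_mul_comm {a b : E n → ℝ} (ha : ContDiff ℝ ∞ a) (hb : ContDiff ℝ ∞ b)
    (hbc : HasCompactSupport b) :
    ∫ x, Laplacian.laplacian a x * b x = ∫ x, a x * Laplacian.laplacian b x := by
  obtain ⟨ρ, hρ, hρb⟩ := hbc.isCompact.isBounded.subset_ball_lt 0 0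
  -- A cutoff equal to 1 near the support of b makes a Schwartz function out of a without changing
  -- either integrand.
  let χ : ContDiffBump (0 : E n) := ⟨ρ, ρ + 1, hρ, by linarith⟩
  have hχc : HasCompactSupport fun x => χ x * a x := χ.hasCompactSupport.mul_right
  have hχs : ContDiff ℝ ∞ fun x => χ x * a x := χ.contDiff.mul ha
  let A : 𝓢(E n, ℝ) := hχc.toSchwartzMap hχs
  let B : 𝓢(E n, ℝ) := hbc.toSchwartzMap hb
  have hA : ∀ x, A x = χ x * a x := fun x => rfl
  have hB : ∀ x, B x = b x := fun x => rfl
  have hnear : ∀ x ∈ tsupport b, (A : E n → ℝ) =ᶠ[nhds x] a := by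
    intro x hx
    filter_upwards [isOpen_ball.mem_nhds (hρb hx)] with y hy
    rw [hA, χ.one_of_mem_closedBall (ball_subset_closedBall hy), one_mul]
  have key := SchwartzMap.integral_mul_laplacian_right_eq_left (μ := volume) A B
  have e1 : ∀ x, (Laplacian.laplacian A : 𝓢(E n, ℝ)) x * B x = Laplacian.laplacian a x * b x := by
    intro x
    by_cases hx : x ∈ tsupport b
    · rw [SchwartzMap.laplacian_apply,
        (InnerProductSpace.laplacian_congr_nhds (hnear x hx)).eq_of_nhds, hB]
    · rw [hB, image_eq_zero_of_notMem_tsupport hx, mul_zero, mul_zero]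
  have e2 : ∀ x, A x * (Laplacian.laplacian B : 𝓢(E n, ℝ)) x = a x * Laplacian.laplacian b x := by
    intro x
    rw [SchwartzMap.laplacian_apply]
    change A x * Laplacian.laplacian b x = _
    by_cases hx : x ∈ tsupport b
    · rw [(hnear x hx).eq_of_nhds]
    · have h0 : b =ᶠ[nhds x] fun _ => 0 := notMem_tsupport_iff_eventuallyEq.1 hx
      rw [(InnerProductSpace.laplacian_congr_nhds h0).eq_of_nhds]
      simp
  simp only [e1, e2] at key
  exact key.symm

theorem contDiff_time_deriv {W : E n → ℝ → ℝ} (hW : ContDiff ℝ ∞ fun p : E n × ℝ => W p.1 p.2) :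
    ContDiff ℝ ∞ (fun p : E n × ℝ => deriv (W p.1) p.2) ∧
      ∀ x t, HasDerivAt (W x) (deriv (W x) t) t := by
  have hd : ∀ x t, HasDerivAt (W x) (fderiv ℝ (fun p : E n × ℝ => W p.1 p.2) (x, t) (0, 1)) t := by
    intro x t
    have h1 : HasDerivAt (fun τ : ℝ => ((x, τ) : E n × ℝ)) (0, 1) t :=
      (hasDerivAt_const t x).prodMk (hasDerivAt_id t)
    exact ((hW.differentiable (by simp)) (x, t)).hasFDerivAt.comp_hasDerivAt t h1
  refine ⟨?_, fun x t => (hd x t).differentiableAt.hasDerivAt⟩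
  have e : (fun p : E n × ℝ => deriv (W p.1) p.2) =
      fun p => fderiv ℝ (fun p : E n × ℝ => W p.1 p.2) p (0, 1) :=
    funext fun p => (hd p.1 p.2).deriv
  rw [e]
  exact (hW.fderiv_right (m := ∞) (by simp)).clm_apply contDiff_const

/-- Differentiation under the integral sign for integrands with locally uniformly bounded
support. -/
theorem hasDerivAt_integral_of_bounded_support {G G' : E n → ℝ → ℝ}
    (hG : Continuous fun p : E n × ℝ => G p.1 p.2) (hG' : Continuous fun p : E n × ℝ => G' p.1 p.2)
    (hd : ∀ x t, HasDerivAt (G x) (G' x t) t) {t₀ K : ℝ}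
    (hs : ∀ t ∈ ball t₀ 1, ∀ x, K < ‖x‖ → G x t = 0 ∧ G' x t = 0) :
    HasDerivAt (fun t => ∫ x, G x t) (∫ x, G' x t₀) t₀ := by
  have hKc : IsCompact (closedBall (0 : E n) K ×ˢ closedBall t₀ 1) :=
    (isCompact_closedBall _ _).prod (isCompact_closedBall _ _)
  obtain ⟨M, hM⟩ := hKc.exists_bound_of_continuousOn hG'.continuousOn
  have hGt : ∀ t, Continuous fun x => G x t := fun t => by fun_prop
  have hGt' : ∀ t, Continuous fun x => G' x t := fun t => by fun_prop
  refine (hasDerivAt_integral_of_dominated_loc_of_deriv_le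
    (bound := (closedBall (0 : E n) K).indicator fun _ => M)
    (F := fun t x => G x t) (F' := fun t x => G' x t)
    (ball_mem_nhds t₀ one_pos) (.of_forall fun t => (hGt t).aestronglyMeasurable)
    ?_ (hGt' t₀).aestronglyMeasurable (.of_forall fun x t ht => ?_) ?_
    (.of_forall fun x t _ => hd x t)).2
  · refine (hGt t₀).integrable_of_hasCompactSupport
      (HasCompactSupport.intro (isCompact_closedBall 0 K) fun x hx => ?_)
    exact (hs t₀ (mem_ball_self one_pos) x (by simpa using hx)).1
  · by_cases hx : x ∈ closedBall (0 : E n) K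
    · rw [indicator_of_mem hx]
      exact hM (x, t) ⟨hx, ball_subset_closedBall ht⟩
    · rw [indicator_of_notMem hx, (hs t ht x (by simpa using hx)).2, norm_zero]
  · rw [integrable_indicator_iff measurableSet_closedBall]
    exact integrableOn_const (isCompact_closedBall _ _).measure_lt_top.ne

theorem deriv_eq_zero_outside {W : E n → ℝ → ℝ} {R : ℝ}
    (h : ∀ x t, R + |t| < ‖x‖ → W x t = 0) (x : E n) (t : ℝ) (ht : R + |t| < ‖x‖) :
    deriv (W x) t = 0 := by
  have : W x =ᶠ[nhds t] fun _ => 0 := by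
    have hc : Continuous fun τ : ℝ => R + |τ| := by fun_prop
    filter_upwards [hc.continuousAt.eventually (gt_mem_nhds ht)] with τ hτ using h x τ hτ
  rw [this.deriv_eq, deriv_const]

theorem IsWaveSolution.deriv_deriv {f g : E n → ℝ} {w : E n → ℝ → ℝ} (h : IsWaveSolution f g w)
    (x : E n) (t : ℝ) :
    deriv (fun τ => deriv (w x) τ) t = Laplacian.laplacian (fun y => w y t) x := by
  have := sub_eq_zero.1 (h.wave_eq x t)
  rw [← this, iteratedDeriv_succ, iteratedDeriv_one]

/-- Conservation of the symplectic pairing of two solutions, one of which has bounded support in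
space at each time. -/
theorem integral_mul_final_eq_zero {w v : E n → ℝ → ℝ} {h : E n → ℝ}
    (hw : IsWaveSolution (fun _ => 0) (fun _ => 0) w) (hv : IsWaveSolution (fun _ => 0) h v)
    {R : ℝ} (hR : ∀ x t, R + |t| < ‖x‖ → v x t = 0) (T : ℝ) : ∫ x, w x T * h x = 0 := by
  obtain ⟨cw, dw⟩ := contDiff_time_deriv hw.smooth
  obtain ⟨cw2, dw2⟩ := contDiff_time_deriv (W := fun x => deriv (w x)) cw
  obtain ⟨cv, dv⟩ := contDiff_time_deriv hv.smooth
  obtain ⟨cv2, dv2⟩ := contDiff_time_deriv (W := fun x => deriv (v x)) cv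
  have hR1 := deriv_eq_zero_outside hR
  have hR2 := deriv_eq_zero_outside (W := fun x => deriv (v x)) hR1
  -- The pairing of w with the time reversal of v about T: its integral is 0 at t = 0 by the data of
  -- w and is ∫ w(T) h at t = T by the data of v.
  let G : E n → ℝ → ℝ := fun x t => deriv (w x) t * v x (T - t) + w x t * deriv (v x) (T - t)
  let G' : E n → ℝ → ℝ := fun x t =>
    deriv (deriv (w x)) t * v x (T - t) - w x t * deriv (deriv (v x)) (T - t)
  have hGc : Continuous fun p : E n × ℝ => G p.1 p.2 := by
    have h1 := hw.smooth.continuous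
    have h2 := cw.continuous
    have h3 : Continuous fun p : E n × ℝ => v p.1 (T - p.2) :=
      hv.smooth.continuous.comp (continuous_fst.prodMk (continuous_const.sub continuous_snd))
    have h4 : Continuous fun p : E n × ℝ => deriv (v p.1) (T - p.2) :=
      cv.continuous.comp (continuous_fst.prodMk (continuous_const.sub continuous_snd))
    exact (h2.mul h3).add (h1.mul h4)
  have hGc' : Continuous fun p : E n × ℝ => G' p.1 p.2 := by
    have h1 := hw.smooth.continuous
    have h2 := cw2.continuous
    have h3 : Continuous fun p : E n × ℝ => v p.1 (T - p.2) :=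
      hv.smooth.continuous.comp (continuous_fst.prodMk (continuous_const.sub continuous_snd))
    have h4 : Continuous fun p : E n × ℝ => deriv (deriv (v p.1)) (T - p.2) :=
      cv2.continuous.comp (continuous_fst.prodMk (continuous_const.sub continuous_snd))
    exact (h2.mul h3).sub (h1.mul h4)
  have hd : ∀ x t, HasDerivAt (G x) (G' x t) t := by
    intro x t
    have hs : HasDerivAt (fun τ : ℝ => T - τ) (-1) t := by
      simpa using (hasDerivAt_id t).const_sub T
    have h1 : HasDerivAt (fun τ => v x (T - τ)) (deriv (v x) (T - t) * -1) t :=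
      (dv x (T - t)).comp t hs
    have h2 : HasDerivAt (fun τ => deriv (v x) (T - τ)) (deriv (deriv (v x)) (T - t) * -1) t :=
      (dv2 x (T - t)).comp t hs
    convert! ((dw2 x t).mul h1).add ((dw x t).mul h2) using 1
    simp only [G']
    ring
  -- By the wave equations, the time derivative of the pairing is the difference of the two sides of
  -- Green's identity.
  have hGreen : ∀ t, ∫ x, G' x t = 0 := by
    intro t
    have hsm : ∀ {W : E n → ℝ → ℝ}, (ContDiff ℝ ∞ fun p : E n × ℝ => W p.1 p.2) → ∀ s,
        ContDiff ℝ ∞ fun x => W x s := fun hW s => hW.comp (contDiff_id.prodMk contDiff_const)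
    have hcs : HasCompactSupport fun x => v x (T - t) :=
      HasCompactSupport.intro (isCompact_closedBall 0 (R + |T - t|)) fun x hx =>
        hR x _ (by simpa using hx)
    have key := integral_laplacian_mul_comm (hsm hw.smooth t) (hsm hv.smooth (T - t)) hcs
    have e : ∀ x, G' x t = Laplacian.laplacian (fun y => w y t) x * v x (T - t) -
        w x t * Laplacian.laplacian (fun y => v y (T - t)) x := by
      intro x
      rw [← hw.deriv_deriv, ← hv.deriv_deriv]
    have hci : ∀ {u : E n → ℝ}, Continuous u → (∀ x, R + |T - t| < ‖x‖ → u x = 0) →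
        Integrable u := fun hu h0 => hu.integrable_of_hasCompactSupport
      (HasCompactSupport.intro (isCompact_closedBall 0 (R + |T - t|)) fun x hx =>
        h0 x (by simpa using hx))
    simp only [e]
    rw [integral_sub, key, sub_self]
    · refine hci ?_ fun x hx => by rw [hR x _ hx, mul_zero]
      simp only [← hw.deriv_deriv]
      exact (hsm cw2 t).continuous.mul (hsm hv.smooth (T - t)).continuous
    · refine hci ?_ fun x hx => ?_
      · simp only [← hv.deriv_deriv]
        exact (hsm hw.smooth t).continuous.mul (hsm cv2 (T - t)).continuous
      · rw [← hv.deriv_deriv, hR2 x _ hx, mul_zero]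
  have hA : ∀ t, HasDerivAt (fun t => ∫ x, G x t) 0 t := by
    intro t₀
    rw [← hGreen t₀]
    refine hasDerivAt_integral_of_bounded_support hGc hGc' hd (K := R + (|T - t₀| + 1))
      fun t ht x hx => ?_
    have h1 : |T - t| ≤ |T - t₀| + 1 := by
      have h2 : |t₀ - t| < 1 := by rw [abs_sub_comm]; exact ht
      have h3 := abs_add_le (T - t₀) (t₀ - t)
      rw [sub_add_sub_cancel] at h3
      linarith
    have h4 : R + |T - t| < ‖x‖ := by linarith
    simp only [G, G']
    rw [hR x _ h4, hR1 x _ h4, hR2 x _ h4]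
    simp
  have hconst := is_const_of_deriv_eq_zero (fun t => (hA t).differentiableAt)
    (fun t => (hA t).deriv) T 0
  have e0 : ∫ x, G x 0 = 0 := by
    have : ∀ x, G x 0 = 0 := fun x => by
      simp only [G]
      rw [hw.initial_value, hw.initial_velocity]
      simp
    simp [this]
  have eT : ∀ x, G x T = w x T * h x := fun x => by
    simp only [G, sub_self]
    rw [hv.initial_value, hv.initial_velocity]
    simp
  rw [e0] at hconst
  simpa only [eT] using hconst

/-- Any test function g is the initial velocity of a sine solution, whose support in space is
bounded at each time by finite speed. Conservation of the pairing gives ∫ w(t) g = 0 for all such g.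
-/
theorem eq_zero_of_isWaveSolution_zero {m : ℕ} (hm : 1 ≤ m) (hnm : n = 2 * m + 1)
    {w : E n → ℝ → ℝ} (hw : IsWaveSolution (fun _ => 0) (fun _ => 0) w) (x : E n) (t : ℝ) :
    w x t = 0 := by
  have hc : Continuous fun x => w x t := by
    have := hw.smooth.continuous
    fun_prop
  have hae : ∀ᵐ x, w x t = 0 := by
    refine ae_eq_zero_of_integral_contDiff_smul_eq_zero hc.locallyIntegrable fun g hg hgc => ?_
    obtain ⟨R, hR⟩ := hgc.isCompact.isBounded.subset_closedBall 0
    have hF : ∀ y, R < ‖y‖ → toSchwartz g hg hgc y = 0 := fun y hy => by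
      have h0 : g y = 0 := image_eq_zero_of_notMem_tsupport
        fun h => not_le.2 hy (by simpa using hR h)
      rw [toSchwartz_apply, h0, Complex.ofReal_zero]
    have hv := isWaveSolution_sinWave (by omega) (toSchwartz g hg hgc)
    have hsupp : ∀ x t, R + |t| < ‖x‖ → (sinWave (toSchwartz g hg hgc) x t).re = 0 := by
      intro x t hx
      -- Finite speed is known for t times the solution, which says nothing at t = 0; there the
      -- initial value is used.
      rcases eq_or_ne t 0 with rfl | ht
      · exact hv.initial_value x
      · have h1 : (t : ℂ) * sinWave (toSchwartz g hg hgc) x t = 0 :=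
          (isConeMean_sinWave hm hnm (toSchwartz g hg hgc)).eq_zero hF
            (show |t| < ‖x‖ - R by linarith)
        have h2 : sinWave (toSchwartz g hg hgc) x t = 0 :=
          (mul_eq_zero.1 h1).resolve_left (by exact_mod_cast ht)
        rw [h2, Complex.zero_re]
    have key := integral_mul_final_eq_zero hw hv hsupp t
    simpa [toSchwartz_apply, mul_comm] using key
  exact congrFun ((hc.ae_eq_iff_eq volume continuous_const).1 hae) x

theorem IsWaveSolution.unique {m : ℕ} (hm : 1 ≤ m) (hnm : n = 2 * m + 1) {f g : E n → ℝ}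
    {w w' : E n → ℝ → ℝ} (h : IsWaveSolution f g w) (h' : IsWaveSolution f g w') : w = w' := by
  have hsub : IsWaveSolution (fun _ => 0) (fun _ => 0) fun x t => w x t - w' x t := by
    obtain ⟨cw, dw⟩ := contDiff_time_deriv h.smooth
    obtain ⟨cw', dw'⟩ := contDiff_time_deriv h'.smooth
    have hsm : ∀ {W : E n → ℝ → ℝ}, (ContDiff ℝ ∞ fun p : E n × ℝ => W p.1 p.2) → ∀ s x,
        ContDiffAt ℝ 2 (fun x => W x s) x := fun hW s x =>
      ((hW.comp (contDiff_id.prodMk contDiff_const)).of_le (by norm_cast)).contDiffAt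
    have hd : ∀ x t, HasDerivAt (fun τ => w x τ - w' x τ) (deriv (w x) t - deriv (w' x) t) t :=
      fun x t => (dw x t).sub (dw' x t)
    refine ⟨h.smooth.sub h'.smooth, fun x t => ?_, fun x => ?_, fun x => ?_⟩
    · have e1 := ContDiffAt.laplacian_sub (hsm h.smooth t x) (hsm h'.smooth t x)
      have e2 : iteratedDeriv 2 (fun τ => w x τ - w' x τ) t =
          deriv (deriv (w x)) t - deriv (deriv (w' x)) t := by
        rw [iteratedDeriv_succ, iteratedDeriv_one, funext fun t => (hd x t).deriv]
        exact (((contDiff_time_deriv (W := fun x => deriv (w x)) cw).2 x t).sub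
          ((contDiff_time_deriv (W := fun x => deriv (w' x)) cw').2 x t)).deriv
      rw [e2, sub_eq_zero, h.deriv_deriv, h'.deriv_deriv]
      exact e1.symm
    · rw [h.initial_value, h'.initial_value, sub_self]
    · have e1 : deriv (w x) 0 = g x := h.initial_velocity x
      have e2 : deriv (w' x) 0 = g x := h'.initial_velocity x
      rw [(hd x 0).deriv, e1, e2, sub_self]
  funext x t
  exact sub_eq_zero.1 (eq_zero_of_isWaveSolution_zero hm hnm hsub x t)

theorem waveSolution_eq {m : ℕ} (hm : 1 ≤ m) (hnm : n = 2 * m + 1) {f g : E n → ℝ}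
    {w : E n → ℝ → ℝ} (h : IsWaveSolution f g w) : waveSolution f g = w :=
  IsWaveSolution.unique hm hnm (Classical.epsilon_spec (p := IsWaveSolution f g) ⟨w, h⟩) h

end Uniqueness

/-! ### Inversion in the unit sphere. -/

section Inversion

variable {n : ℕ}

theorem inversion_zero_one (z : E n) :
    EuclideanGeometry.inversion 0 1 z = (‖z‖ ^ 2)⁻¹ • z := by
  simp [EuclideanGeometry.inversion]

/-- Change of variables by inversion in the unit sphere. -/
theorem integral_comp_inversion (hn : 1 ≤ n) (g : E n → ℂ) :
    ∫ y, g y = ∫ z, (((‖z‖ ^ 2) ^ n)⁻¹ : ℝ) * g ((‖z‖ ^ 2)⁻¹ • z) := by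
  have : Nontrivial (E n) := Module.nontrivial_of_finrank_pos (R := ℝ) (by simp; omega)
  have key := integral_image_eq_integral_abs_det_fderiv_smul (volume : Measure (E n))
    (s := {(0 : E n)}ᶜ) (f := EuclideanGeometry.inversion 0 1)
    (measurableSet_singleton _).compl
    (fun z hz => (EuclideanGeometry.hasFDerivAt_inversion (c := (0 : E n)) (R := 1)
      hz).hasFDerivWithinAt)
    ((EuclideanGeometry.inversion_injective 0 one_ne_zero).injOn) g
  have himg : EuclideanGeometry.inversion (0 : E n) 1 '' {(0 : E n)}ᶜ = {(0 : E n)}ᶜ := by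
    rw [image_compl_eq (EuclideanGeometry.inversion_bijective 0 one_ne_zero), image_singleton,
      EuclideanGeometry.inversion_self]
  rw [himg, restrict_compl_singleton] at key
  rw [key]
  refine integral_congr_ae (.of_forall fun z => ?_)
  -- The derivative of the inversion is |z|⁻² times a reflection, so the Jacobian is |z|^(-2n).
  have hdet : |((1 / dist z 0) ^ 2 • ((ℝ ∙ (z - 0))ᗮ.reflection : E n →L[ℝ] E n)).det| =
      ((‖z‖ ^ 2) ^ n)⁻¹ := by
    have h1 : ((1 / dist z 0) ^ 2 • ((ℝ ∙ (z - 0))ᗮ.reflection : E n →L[ℝ] E n)).det =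
        ((1 / dist z 0) ^ 2) ^ n *
          LinearMap.det ((ℝ ∙ (z - 0))ᗮ.reflection : E n ≃ₗᵢ[ℝ] E n).toLinearMap := by
      have := LinearMap.det_smul ((1 / dist z 0) ^ 2)
        ((ℝ ∙ (z - 0))ᗮ.reflection : E n ≃ₗᵢ[ℝ] E n).toLinearMap
      rw [finrank_euclideanSpace_fin] at this
      exact this
    have h2 : |LinearMap.det ((ℝ ∙ (z - 0))ᗮ.reflection : E n ≃ₗᵢ[ℝ] E n).toLinearMap| = 1 := by
      rw [Submodule.det_reflection, abs_pow, abs_neg, abs_one, one_pow]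
    rw [h1, abs_mul, h2, mul_one, dist_zero_right, abs_of_nonneg (by positivity), one_div, inv_pow,
      inv_pow]
  simp only [hdet, inversion_zero_one, Complex.real_smul]

/-- The inversion of a function in the unit sphere, weighted by a power of the norm. -/
def kelvin (j : ℕ) (f : E n → ℝ) (z : E n) : ℝ := ((‖z‖ ^ 2) ^ j)⁻¹ * f ((‖z‖ ^ 2)⁻¹ • z)

theorem norm_inv_smul (z : E n) : ‖(‖z‖ ^ 2)⁻¹ • z‖ = ‖z‖⁻¹ := by
  rcases eq_or_ne z 0 with rfl | hz
  · simp
  · have : ‖z‖ ≠ 0 := norm_ne_zero_iff.2 hz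
    rw [norm_smul, norm_inv, norm_pow, norm_norm]
    field_simp

theorem IsTestFunctionOffZero.exists_bounds {f : E n → ℝ} (hf : IsTestFunctionOffZero f) :
    ∃ r > 0, ∃ R > 0, ∀ y, ‖y‖ < r ∨ R < ‖y‖ → f y = 0 := by
  obtain ⟨hs, hc, h0⟩ := hf
  obtain ⟨r, hr, hb⟩ := Metric.eventually_nhds_iff.1 (notMem_tsupport_iff_eventuallyEq.1 h0)
  obtain ⟨R, hR, hRb⟩ := hc.isCompact.isBounded.subset_closedBall_lt 0 0
  refine ⟨r, hr, R, hR, fun y hy => ?_⟩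
  rcases hy with h | h
  · exact hb (by simpa using h)
  · exact image_eq_zero_of_notMem_tsupport fun h' => not_le.2 h (by simpa using hRb h')

/-- Inversion exchanges 0 and infinity: compact support of f gives vanishing near 0, hence
smoothness there, and vanishing of f near 0 gives compact support. -/
theorem IsTestFunctionOffZero.contDiff_kelvin {f : E n → ℝ} (hf : IsTestFunctionOffZero f)
    (j : ℕ) : ContDiff ℝ ∞ (kelvin j f) := by
  obtain ⟨r, hr, R, hR, h⟩ := hf.exists_bounds
  rw [contDiff_iff_contDiffAt]
  intro z
  rcases eq_or_ne z 0 with rfl | hz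
  · have : kelvin j f =ᶠ[nhds 0] fun _ => 0 := by
      filter_upwards [ball_mem_nhds (0 : E n) (inv_pos.2 hR)] with z hz
      rw [kelvin, h, mul_zero]
      rcases eq_or_ne z 0 with rfl | hz0
      · simp [hr]
      · right
        rw [norm_inv_smul]
        exact lt_inv_of_lt_inv₀ (norm_pos_iff.2 hz0) (by simpa using hz)
    exact contDiffAt_const.congr_of_eventuallyEq this
  · have hn : ‖z‖ ^ 2 ≠ 0 := pow_ne_zero _ (norm_ne_zero_iff.2 hz)
    have h1 : ContDiffAt ℝ ∞ (fun z : E n => ‖z‖ ^ 2) z := (contDiff_norm_sq ℝ).contDiffAt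
    exact ((h1.pow j).inv (pow_ne_zero _ hn)).mul
      (hf.1.contDiffAt.comp z ((h1.inv hn).smul contDiffAt_id))

theorem IsTestFunctionOffZero.hasCompactSupport_kelvin {f : E n → ℝ}
    (hf : IsTestFunctionOffZero f) (j : ℕ) : HasCompactSupport (kelvin j f) := by
  obtain ⟨r, hr, R, hR, h⟩ := hf.exists_bounds
  refine HasCompactSupport.intro (isCompact_closedBall 0 r⁻¹) fun z hz => ?_
  rw [kelvin, h, mul_zero]
  left
  rw [norm_inv_smul]
  have hz' : r⁻¹ < ‖z‖ := by simpa using hz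
  exact inv_lt_of_inv_lt₀ hr hz'

theorem kelvin_inversion (j : ℕ) (f : E n → ℝ) {x : E n} (hx : x ≠ 0) :
    kelvin j f ((‖x‖ ^ 2)⁻¹ • x) = (‖x‖ ^ 2) ^ j * f x := by
  have h : ‖x‖ ≠ 0 := norm_ne_zero_iff.2 hx
  have h1 : ((‖x‖⁻¹ ^ 2)⁻¹) • (‖x‖ ^ 2)⁻¹ • x = x := by
    rw [smul_smul, inv_pow, inv_inv, mul_inv_cancel₀ (pow_ne_zero 2 h), one_smul]
  rw [kelvin, norm_inv_smul, h1, inv_pow, inv_pow, inv_inv]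

/-- Plane-wave averages of the inverted function. -/
theorem integral_kelvin_mul {m k : ℕ} (hnm : n = 2 * m + 1) (hk : k ≤ 2 * m) (f : E n → ℝ)
    (χ : ℝ → ℝ) (θ : E n) :
    ∫ z, (kelvin (2 * m - k) f z : ℂ) * χ (inner ℝ z θ) =
      ∫ y, (f y * ((‖y‖ ^ 2) ^ (k + 1))⁻¹ * χ (inner ℝ y θ / ‖y‖ ^ 2) : ℝ) := by
  rw [← integral_complex_ofReal, integral_comp_inversion (by omega)
    (fun y => ((f y * ((‖y‖ ^ 2) ^ (k + 1))⁻¹ * χ (inner ℝ y θ / ‖y‖ ^ 2) : ℝ) : ℂ))]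
  have hnt : Nontrivial (E n) := Module.nontrivial_of_finrank_pos (R := ℝ) (by simp; omega)
  refine integral_congr_ae ?_
  filter_upwards [compl_mem_ae_iff.2 (measure_singleton (0 : E n))] with z hz
  have h : ‖z‖ ≠ 0 := norm_ne_zero_iff.2 hz
  have h1 : inner ℝ ((‖z‖ ^ 2)⁻¹ • z) θ / ‖(‖z‖ ^ 2)⁻¹ • z‖ ^ 2 = inner ℝ z θ := by
    rw [norm_inv_smul, real_inner_smul_left]
    field_simp
  simp only [h1, kelvin]
  rw [norm_inv_smul]
  -- Bookkeeping of weights: n = (2m - k) + (k + 1), the Jacobian being shared between the Kelvin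
  -- weight and the weight in y.
  have h2 : ((‖z‖ ^ 2) ^ (2 * m - k))⁻¹ =
      ((‖z‖ ^ 2) ^ n)⁻¹ * (((‖z‖⁻¹) ^ 2) ^ (k + 1))⁻¹ := by
    have h3 : (‖z‖ ^ 2) ^ n = (‖z‖ ^ 2) ^ (2 * m - k) * (‖z‖ ^ 2) ^ (k + 1) := by
      rw [← pow_add]
      congr 1
      omega
    rw [inv_pow, inv_pow, inv_inv, h3, mul_inv, mul_assoc,
      inv_mul_cancel₀ (pow_ne_zero _ (pow_ne_zero _ h)), mul_one]
  rw [h2]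
  push_cast
  ring

end Inversion

/-! ### Test functions adapted to cones with vertex on the line of θ. -/

section Trace

variable {n : ℕ}

/-- With x = θ/(2s), the same affine change of variable sends t² to s t² - 1/(4s) and |x - y|² to
s|y|² - y·θ. The zero levels are the times t = ±|x| and the sphere about x through the origin; the
chain rule yields s^k. -/
theorem IsConeMean.weak_quadric {k : ℕ} {C : ℂ} {F : E n → ℂ} {w : E n → ℝ → ℂ}
    (h : IsConeMean k C F w) {θ : E n} (hθ : ‖θ‖ = 1) {s : ℝ} (hs : s ≠ 0) {η : ℝ → ℝ}
    (hη : ContDiff ℝ ∞ η) (hc : HasCompactSupport η) :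
    ∫ t : ℝ, w ((1 / (2 * s)) • θ) t * η (s * t ^ 2 - 1 / (4 * s)) =
      C * (-1) ^ k * (s ^ k * ∫ y, F y * (iteratedDeriv k η (s * ‖y‖ ^ 2 - inner ℝ y θ) : ℝ)) := by
  have hφ : ContDiff ℝ ∞ fun σ => η (s * σ - 1 / (4 * s)) :=
    hη.comp (by fun_prop)
  have hφc : HasCompactSupport fun σ => η (s * σ - 1 / (4 * s)) := by
    have := hc.comp_homeomorph ((Homeomorph.mulLeft₀ s hs).trans
      (Homeomorph.subRight (1 / (4 * s))))
    exact this
  rw [h.weak _ _ hφ hφc, ← integral_const_mul ((s : ℂ) ^ k)]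
  have e0 : ∀ y : E n, s * ‖(1 / (2 * s)) • θ - y‖ ^ 2 - 1 / (4 * s) =
      s * ‖y‖ ^ 2 - inner ℝ y θ := by
    intro y
    rw [norm_sub_sq_real, norm_smul, hθ, real_inner_smul_left, real_inner_comm, mul_one,
      Real.norm_eq_abs, sq_abs]
    field_simp
    ring
  have e2 : iteratedDeriv k (fun σ => η (s * σ - 1 / (4 * s))) =
      fun σ => s ^ k * iteratedDeriv k η (s * σ - 1 / (4 * s)) := by
    have hη' : ContDiff ℝ ∞ fun u => η (u - 1 / (4 * s)) := hη.comp (by fun_prop)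
    have h1 := iteratedDeriv_comp_const_mul (n := k) (contDiff_infty.1 hη' k) s
    simp only [iteratedDeriv_comp_sub_const] at h1
    exact h1
  refine congrArg _ (integral_congr_ae (.of_forall fun y => ?_))
  simp only [e2, e0]
  push_cast
  ring

/-- Change of variables from time to the value of the defining function of a light cone. -/
theorem integral_comp_quadric {W : ℝ → ℂ} (hW : Continuous W) (heven : ∀ t, W (-t) = W t) {s δ : ℝ}
    (hs : s ≠ 0) (hδ : 4 * |s| * δ ≤ 1) {η : ℝ → ℝ} (hη : Continuous η)
    (h0 : ∀ q, q ∉ Ioo (-δ) δ → η q = 0) :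
    ∫ t : ℝ, W t * η (s * t ^ 2 - 1 / (4 * s)) =
      ∫ q : ℝ, η q * (2 * W (Real.sqrt (1 + 4 * s * q) / (2 * |s|)) / Real.sqrt (1 + 4 * s * q)) := by
  have hs' : 0 < |s| := abs_pos.2 hs
  have hpos : ∀ q ∈ Ioo (-δ) δ, 0 < 1 + 4 * s * q := by
    intro q hq
    have h1 : |4 * s * q| < 1 := by
      rw [abs_mul, abs_mul, abs_of_pos (by norm_num : (0 : ℝ) < 4)]
      exact (mul_lt_mul_of_pos_left (abs_lt.2 hq) (by positivity)).trans_le hδ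
    linarith [(abs_lt.1 h1).1]
  -- The positive root of s t² - 1/(4s) = q; at q = 0 it is |x| = 1/(2|s|). The bound on δ keeps the
  -- radicand positive.
  set T : ℝ → ℝ := fun q => Real.sqrt (1 + 4 * s * q) / (2 * |s|) with hT
  set G : ℝ → ℂ := fun t => W t * η (s * t ^ 2 - 1 / (4 * s)) with hG
  have hsq : ∀ q ∈ Ioo (-δ) δ, s * T q ^ 2 - 1 / (4 * s) = q := by
    intro q hq
    rw [hT]
    simp only
    rw [div_pow, Real.sq_sqrt (hpos q hq).le, mul_pow, sq_abs]
    field_simp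
    ring
  have hGc : Continuous G := by fun_prop
  have hGi : Integrable G := by
    refine hGc.integrable_of_hasCompactSupport (HasCompactSupport.intro
      (isCompact_closedBall (0 : ℝ) (1 + (δ + 1 / (4 * |s|)) / |s|)) fun t ht => ?_)
    simp only [hG]
    rw [h0, Complex.ofReal_zero, mul_zero]
    intro hq
    have h1 : |s * t ^ 2 - 1 / (4 * s)| < δ := abs_lt.2 hq
    have h2 : |s| * t ^ 2 ≤ δ + 1 / (4 * |s|) := by
      have h3 := abs_sub_abs_le_abs_sub (s * t ^ 2) (1 / (4 * s))
      rw [abs_mul, abs_of_nonneg (sq_nonneg t), abs_div, abs_mul, abs_one,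
        abs_of_pos (by norm_num : (0 : ℝ) < 4)] at h3
      linarith
    have h3 : t ^ 2 ≤ (δ + 1 / (4 * |s|)) / |s| := by
      rw [le_div_iff₀ hs', mul_comm]
      exact h2
    have h4 : 1 + (δ + 1 / (4 * |s|)) / |s| < |t| := by simpa using ht
    have h5 := sq_abs t
    nlinarith [sq_nonneg (|t| - 1), abs_nonneg t]
  have hGe : ∀ t, G (-t) = G t := fun t => by simp only [hG, heven, neg_sq]
  have himg : T '' Ioo (-δ) δ ⊆ Ioi 0 := by
    rintro _ ⟨q, hq, rfl⟩
    exact div_pos (Real.sqrt_pos.2 (hpos q hq)) (by positivity)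
  have hinj : InjOn T (Ioo (-δ) δ) := by
    intro a ha b hb hab
    rw [← hsq a ha, ← hsq b hb, hab]
  have hder : ∀ q ∈ Ioo (-δ) δ, HasDerivWithinAt T
      (4 * s / (2 * Real.sqrt (1 + 4 * s * q)) / (2 * |s|)) (Ioo (-δ) δ) q := by
    intro q hq
    have h1 : HasDerivAt (fun q => 1 + 4 * s * q) (4 * s) q := by
      simpa using ((hasDerivAt_id q).const_mul (4 * s)).const_add 1
    exact ((h1.sqrt (hpos q hq).ne').div_const _).hasDerivWithinAt
  have hzero : ∀ t ∈ Ioi (0 : ℝ) \ T '' Ioo (-δ) δ, G t = 0 := by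
    rintro t ⟨ht, ht'⟩
    simp only [hG]
    rw [h0, Complex.ofReal_zero, mul_zero]
    intro hq
    refine ht' ⟨_, hq, ?_⟩
    simp only [hT]
    have h1 : 1 + 4 * s * (s * t ^ 2 - 1 / (4 * s)) = (2 * |s| * t) ^ 2 := by
      rw [mul_pow, mul_pow, sq_abs]
      field_simp
      ring
    rw [h1, Real.sqrt_sq (by have := mem_Ioi.1 ht; positivity)]
    field_simp
  have hfull : ∫ q in Ioo (-δ) δ, (η q : ℂ) *
        (2 * W (Real.sqrt (1 + 4 * s * q) / (2 * |s|)) / Real.sqrt (1 + 4 * s * q)) =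
      ∫ q : ℝ, η q * (2 * W (Real.sqrt (1 + 4 * s * q) / (2 * |s|)) / Real.sqrt (1 + 4 * s * q)) :=
    setIntegral_eq_integral_of_forall_compl_eq_zero fun q hq => by
      rw [h0 q hq, Complex.ofReal_zero, zero_mul]
  rw [integral_even hGi hGe, setIntegral_eq_of_subset_of_forall_sdiff_eq_zero measurableSet_Ioi
    himg hzero, integral_image_eq_integral_abs_deriv_smul measurableSet_Ioo hder hinj,
    ← integral_const_mul, ← hfull]
  refine setIntegral_congr_fun measurableSet_Ioo fun q hq => ?_
  have h1 : 0 < Real.sqrt (1 + 4 * s * q) := Real.sqrt_pos.2 (hpos q hq)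
  have h2 : |4 * s / (2 * Real.sqrt (1 + 4 * s * q)) / (2 * |s|)| =
      (Real.sqrt (1 + 4 * s * q))⁻¹ := by
    rw [abs_div, abs_div, abs_mul, abs_mul, abs_mul, abs_abs, abs_of_pos h1,
      abs_of_pos (by norm_num : (0 : ℝ) < 4), abs_of_pos (by norm_num : (0 : ℝ) < 2)]
    field_simp
    norm_num
  simp only [h2, hG, hsq q hq, Complex.real_smul]
  push_cast
  ring

theorem contDiff_iteratedDeriv_infty {G : Type*} [NormedAddCommGroup G] [NormedSpace ℝ G] (k : ℕ)
    {η : ℝ → G} (hη : ContDiff ℝ ∞ η) :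
    ContDiff ℝ ∞ (iteratedDeriv k η) := by
  rw [iteratedDeriv_eq_iterate]
  exact hη.iterate_deriv k

/-- Repeated integration by parts along an affine map. -/
theorem integral_mul_iteratedDeriv_affine (k : ℕ) {ψ η : ℝ → ℝ} (hψ : ContDiff ℝ ∞ ψ)
    (hψc : HasCompactSupport ψ) (hη : ContDiff ℝ ∞ η) {a : ℝ} (ha : a ≠ 0) (c : ℝ) :
    ∫ s, ψ s * iteratedDeriv k η (s * a - c) =
      (-1) ^ k * (a ^ k)⁻¹ * ∫ s, iteratedDeriv k ψ s * η (s * a - c) := by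
  induction k generalizing ψ with
  | zero => simp
  | succ k ih =>
    have hηk := contDiff_iteratedDeriv_infty k hη
    have hd : ∀ s, HasDerivAt (fun s => iteratedDeriv k η (s * a - c))
        (iteratedDeriv (k + 1) η (s * a - c) * a) s := by
      intro s
      have h1 : HasDerivAt (fun s => s * a - c) a s := by
        simpa using ((hasDerivAt_id s).mul_const a).sub_const c
      have h2 : HasDerivAt (iteratedDeriv k η) (iteratedDeriv (k + 1) η (s * a - c)) (s * a - c) := by
        rw [iteratedDeriv_succ]
        exact (hηk.differentiable (by simp) _).hasDerivAt
      exact h2.comp s h1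
    have hψ' := contDiff_deriv_infty hψ
    have c1 : Continuous fun s => iteratedDeriv k η (s * a - c) :=
      hηk.continuous.comp (by fun_prop)
    have c2 : Continuous fun s => iteratedDeriv (k + 1) η (s * a - c) * a := by
      have : Continuous (iteratedDeriv (k + 1) η) := by
        rw [iteratedDeriv_succ]
        exact (contDiff_deriv_infty hηk).continuous
      exact (this.comp (by fun_prop)).mul continuous_const
    have key := integral_mul_deriv_eq_deriv_mul_of_integrable (u := ψ) (u' := deriv ψ)
      (v := fun s => iteratedDeriv k η (s * a - c))
      (fun s _ => (hψ.differentiable (by simp) s).hasDerivAt) (fun s _ => hd s)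
      ((hψ.continuous.mul c2).integrable_of_hasCompactSupport hψc.mul_right)
      ((hψ'.continuous.mul c1).integrable_of_hasCompactSupport hψc.deriv.mul_right)
      ((hψ.continuous.mul c1).integrable_of_hasCompactSupport hψc.mul_right)
    rw [ih hψ' hψc.deriv] at key
    simp only [← mul_assoc] at key
    rw [integral_mul_const] at key
    rw [iteratedDeriv_succ' (f := ψ), eq_div_of_mul_eq ha key, pow_succ, pow_succ, mul_inv]
    ring

theorem integral_comp_affine (G : ℝ → ℝ) {a : ℝ} (ha : 0 < a) (c : ℝ) :
    ∫ s, G (s * a - c) = a⁻¹ * ∫ q, G q := by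
  rw [Measure.integral_comp_mul_right (fun u => G (u - c)) a, integral_sub_right_eq_self,
    abs_of_pos (inv_pos.2 ha), smul_eq_mul]

end Trace

/-! ### Restriction of the weak formula to the light cone. -/

section Pairing

variable {n : ℕ}

/-- A continuous function on an open set which annihilates all test functions vanishes. -/
theorem eqOn_zero_of_integral_smul_eq_zero {U : Set ℝ} (hU : IsOpen U) {g : ℝ → ℂ}
    (hg : ContinuousOn g U)
    (h : ∀ η : ℝ → ℝ, ContDiff ℝ ∞ η → HasCompactSupport η → tsupport η ⊆ U →
      ∫ x, η x • g x = 0) : EqOn g 0 U := by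
  have h1 := hU.ae_eq_zero_of_integral_contDiff_smul_eq_zero
    (hg.locallyIntegrableOn hU.measurableSet) h
  exact Measure.eqOn_open_of_ae_eq ((ae_restrict_iff' hU.measurableSet).2 h1) hU hg
    continuousOn_const

theorem continuous_integral_of_zero_off {X Y G : Type*} [TopologicalSpace X]
    [FirstCountableTopology X] [LocallyCompactSpace X] [TopologicalSpace Y]
    [SecondCountableTopology Y] [MeasurableSpace Y] [OpensMeasurableSpace Y]
    [NormedAddCommGroup G] [NormedSpace ℝ G] {μ : Measure Y} [IsLocallyFiniteMeasure μ]
    {F : X → Y → G} (hF : Continuous (Function.uncurry F)) {K : Set Y} (hK : IsCompact K)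
    (h0 : ∀ x, ∀ y ∉ K, F x y = 0) : Continuous fun x => ∫ y, F x y ∂μ := by
  have h1 := continuous_parametric_integral_of_continuous (μ := μ) hF hK
  have h2 : (fun x => ∫ y, F x y ∂μ) = fun x => ∫ y in K, F x y ∂μ := by
    funext x
    exact (setIntegral_eq_integral_of_forall_compl_eq_zero (h0 x)).symm
  rw [h2]
  exact h1

/-- The values of `w` along the quadric `s t² - 1 / (4 s) = q`, weighted by `ψ`; for `q = 0` these
are values on the light cone with vertex at the origin. -/
def coneIntegrand (k : ℕ) (w : E n → ℝ → ℂ) (θ : E n) (ψ : ℝ → ℝ) (q s : ℝ) : ℂ :=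
  (ψ s * (s ^ k)⁻¹ : ℝ) * (2 * w ((1 / (2 * s)) • θ)
    (Real.sqrt (max (1 + 4 * s * q) (1 / 2)) / (2 * |s|)) /
      Real.sqrt (max (1 + 4 * s * q) (1 / 2)))

/-- The maximum with 1/2 keeps the root away from 0 for all q and s, so that s = 0 is the only
possible singularity, and the support of ψ avoids it. For q near 0 and s in the support the maximum
is inactive. -/
theorem continuous_coneIntegrand (k : ℕ) {w : E n → ℝ → ℂ}
    (hw : Continuous fun p : E n × ℝ => w p.1 p.2) (θ : E n) {ψ : ℝ → ℝ} (hψ : Continuous ψ)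
    (h0 : (0 : ℝ) ∉ tsupport ψ) : Continuous (Function.uncurry (coneIntegrand k w θ ψ)) := by
  refine continuous_of_tsupport fun p hp => ?_
  have h1 : tsupport (Function.uncurry (coneIntegrand k w θ ψ)) ⊆ Prod.snd ⁻¹' tsupport ψ := by
    refine closure_minimal (fun p hp => ?_) ((isClosed_tsupport ψ).preimage continuous_snd)
    refine subset_tsupport ψ fun h => hp ?_
    simp [Function.uncurry, coneIntegrand, h]
  have hs : p.2 ≠ 0 := fun h => h0 (h ▸ h1 hp)
  have hD : ContinuousAt (fun p : ℝ × ℝ => Real.sqrt (max (1 + 4 * p.2 * p.1) (1 / 2))) p := by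
    fun_prop
  have hpos : Real.sqrt (max (1 + 4 * p.2 * p.1) (1 / 2)) ≠ 0 :=
    (Real.sqrt_pos.2 (lt_max_of_lt_right (by norm_num))).ne'
  have hw' : ContinuousAt (fun p : ℝ × ℝ => w ((1 / (2 * p.2)) • θ)
      (Real.sqrt (max (1 + 4 * p.2 * p.1) (1 / 2)) / (2 * |p.2|))) p := by
    refine ContinuousAt.comp (g := fun p : E n × ℝ => w p.1 p.2)
      (f := fun p : ℝ × ℝ => ((1 / (2 * p.2)) • θ,
        Real.sqrt (max (1 + 4 * p.2 * p.1) (1 / 2)) / (2 * |p.2|))) hw.continuousAt ?_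
    have h2 : ContinuousAt (fun p : ℝ × ℝ => 1 / (2 * p.2)) p :=
      continuousAt_const.div (by fun_prop) (mul_ne_zero two_ne_zero hs)
    have h3 : ContinuousAt (fun p : ℝ × ℝ => 2 * |p.2|) p := by fun_prop
    exact (h2.smul continuousAt_const).prodMk
      (hD.div h3 (mul_ne_zero two_ne_zero (abs_ne_zero.2 hs)))
  have hψ' : ContinuousAt (fun p : ℝ × ℝ => ψ p.2 * (p.2 ^ k)⁻¹) p :=
    (hψ.comp continuous_snd).continuousAt.mul
      ((continuous_snd.pow k).continuousAt.inv₀ (pow_ne_zero _ hs))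
  exact (Complex.continuous_ofReal.continuousAt.comp hψ').mul
    ((continuousAt_const.mul hw').div (Complex.continuous_ofReal.continuousAt.comp hD)
      (Complex.ofReal_ne_zero.2 hpos))

theorem continuous_kelvinIntegrand (k : ℕ) {f : E n → ℝ} (hf : IsTestFunctionOffZero f) (θ : E n)
    {χ : ℝ → ℝ} (hχ : Continuous χ) : Continuous (Function.uncurry fun (q : ℝ) (y : E n) =>
      f y * ((‖y‖ ^ 2) ^ (k + 1))⁻¹ * χ ((q + inner ℝ y θ) / ‖y‖ ^ 2)) := by
  refine continuous_of_tsupport fun p hp => ?_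
  have h1 := closure_minimal (s := Function.support (Function.uncurry fun (q : ℝ) (y : E n) =>
      f y * ((‖y‖ ^ 2) ^ (k + 1))⁻¹ * χ ((q + inner ℝ y θ) / ‖y‖ ^ 2)))
    (t := Prod.snd ⁻¹' tsupport f) (fun p hp => by
      refine subset_tsupport f fun h => hp ?_
      simp [Function.uncurry, h]) ((isClosed_tsupport f).preimage continuous_snd)
  have hs : p.2 ≠ 0 := fun h => hf.2.2 (h ▸ h1 hp)
  have hn : ‖p.2‖ ≠ 0 := norm_ne_zero_iff.2 hs
  have hc := hf.1.continuous
  have a1 : ContinuousAt (fun p : ℝ × E n => ((‖p.2‖ ^ 2) ^ (k + 1))⁻¹) p :=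
    ContinuousAt.inv₀ (by fun_prop) (by positivity)
  have a2 : ContinuousAt (fun p : ℝ × E n => (p.1 + inner ℝ p.2 θ) / ‖p.2‖ ^ 2) p :=
    ContinuousAt.div (by fun_prop) (by fun_prop) (by positivity)
  exact ((hc.comp continuous_snd).continuousAt.mul a1).mul
    (ContinuousAt.comp (g := χ) hχ.continuousAt a2)

/-- Integration over the fibres of the quadrics `s ‖y‖² - y · θ = q`. -/
theorem integral_integral_iteratedDeriv_quadric (k : ℕ) {f : E n → ℝ}
    (hf : IsTestFunctionOffZero f) (θ : E n) {ψ η : ℝ → ℝ} (hψ : ContDiff ℝ ∞ ψ)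
    (hψc : HasCompactSupport ψ) (hη : ContDiff ℝ ∞ η) (hηc : HasCompactSupport η) :
    ∫ s, ∫ y, f y * (ψ s * iteratedDeriv k η (s * ‖y‖ ^ 2 - inner ℝ y θ)) =
      (-1) ^ k * ∫ q, η q * ∫ y, f y * ((‖y‖ ^ 2) ^ (k + 1))⁻¹ *
        iteratedDeriv k ψ ((q + inner ℝ y θ) / ‖y‖ ^ 2) := by
  have hc := hf.1.continuous
  have hηk := (contDiff_iteratedDeriv_infty k hη).continuous
  have hψk := (contDiff_iteratedDeriv_infty k hψ).continuous
  rw [integral_integral_swap_of_hasCompactSupport]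
  rotate_left
  · have := hψ.continuous
    simp only [Function.uncurry_def]
    fun_prop
  · refine HasCompactSupport.intro (hψc.isCompact.prod hf.2.1.isCompact) fun p hp => ?_
    rw [mem_prod, not_and_or] at hp
    rcases hp with hp | hp
    · simp [Function.uncurry, image_eq_zero_of_notMem_tsupport hp]
    · simp [Function.uncurry, image_eq_zero_of_notMem_tsupport hp]
  -- For fixed y, k integrations by parts in s give |y|^(-2k), and the substitution q = s|y|² - y·θ
  -- gives one more |y|⁻²; hence the exponent k + 1.
  have key : ∀ y : E n, ∫ s, f y * (ψ s * iteratedDeriv k η (s * ‖y‖ ^ 2 - inner ℝ y θ)) =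
      (-1) ^ k * ∫ q, η q * (f y * ((‖y‖ ^ 2) ^ (k + 1))⁻¹ *
        iteratedDeriv k ψ ((q + inner ℝ y θ) / ‖y‖ ^ 2)) := by
    intro y
    by_cases hy : f y = 0
    · simp [hy]
    have hy0 : y ≠ 0 := fun h => hf.2.2 (h ▸ subset_tsupport f hy)
    have ha : 0 < ‖y‖ ^ 2 := by positivity
    have h1 := integral_comp_affine
      (fun q => iteratedDeriv k ψ ((q + inner ℝ y θ) / ‖y‖ ^ 2) * η q) ha (inner ℝ y θ)
    have h2 : ∀ s, (s * ‖y‖ ^ 2 - inner ℝ y θ + inner ℝ y θ) / ‖y‖ ^ 2 = s := fun s => by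
      field_simp
      ring
    simp only [h2] at h1
    rw [integral_const_mul, integral_mul_iteratedDeriv_affine k hψ hψc hη ha.ne', h1]
    simp only [← integral_const_mul]
    refine integral_congr_ae (.of_forall fun q => ?_)
    simp only [pow_succ _ k, mul_inv]
    ring
  simp only [key]
  rw [integral_const_mul, integral_integral_swap_of_hasCompactSupport]
  · simp only [integral_const_mul]
  · have h1 := (continuous_kelvinIntegrand k hf θ hψk).comp continuous_swap
    exact (hη.continuous.comp continuous_snd).mul h1
  · refine HasCompactSupport.intro (hf.2.1.isCompact.prod hηc.isCompact) fun p hp => ?_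
    rw [mem_prod, not_and_or] at hp
    rcases hp with hp | hp
    · simp [Function.uncurry, image_eq_zero_of_notMem_tsupport hp]
    · simp [Function.uncurry, image_eq_zero_of_notMem_tsupport hp]

/-- The trace of a cone mean on the light cone with vertex at the origin, in weak form. -/
theorem IsConeMean.integral_trace_mul {k : ℕ} {C : ℂ} {f : E n → ℝ} (hf : IsTestFunctionOffZero f)
    {w : E n → ℝ → ℂ} (h : IsConeMean k C (fun y => (f y : ℂ)) w) {θ : E n} (hθ : ‖θ‖ = 1)
    {ψ : ℝ → ℝ} (hψ : ContDiff ℝ ∞ ψ) (hψc : HasCompactSupport ψ) (h0 : (0 : ℝ) ∉ tsupport ψ) :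
    ∫ s, (ψ s * (s ^ k)⁻¹ : ℝ) * (2 * w ((1 / (2 * s)) • θ) (1 / (2 * |s|))) =
      C * (∫ y, f y * ((‖y‖ ^ 2) ^ (k + 1))⁻¹ *
        iteratedDeriv k ψ (inner ℝ y θ / ‖y‖ ^ 2) : ℝ) := by
  obtain ⟨b, hb, hbs⟩ := hψc.isCompact.isBounded.subset_closedBall_lt 0 0
  have hψk := (contDiff_iteratedDeriv_infty k hψ).continuous
  have hψ0 : ψ 0 = 0 := image_eq_zero_of_notMem_tsupport h0
  have hA := continuous_coneIntegrand k h.cont θ hψ.continuous h0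
  have hB := continuous_kelvinIntegrand k hf θ hψk
  have hA0 : ∀ q, ∀ s ∉ tsupport ψ, coneIntegrand k w θ ψ q s = 0 := fun q s hs => by
    simp [coneIntegrand, image_eq_zero_of_notMem_tsupport hs]
  have hkk := continuous_integral_of_zero_off (μ := volume) hA hψc.isCompact hA0
  have hr := continuous_integral_of_zero_off (μ := volume) hB hf.2.1.isCompact
    (fun q y hy => by rw [image_eq_zero_of_notMem_tsupport hy]; ring)
  -- As |s| ≤ b on the support of ψ, |q| < 1/(8b) ensures |4sq| ≤ 1/2, so the truncation in
  -- `coneIntegrand` plays no role.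
  have hδ : 0 < 1 / (8 * b) := by positivity
  -- Both sides extend to continuous functions of the level q. They agree when tested against every
  -- η supported near 0, hence at q = 0, the light cone itself.
  have key := eqOn_zero_of_integral_smul_eq_zero (isOpen_Ioo (a := -(1 / (8 * b))) (b := 1 / (8 * b)))
    (g := fun q => (∫ s, coneIntegrand k w θ ψ q s) - C * (∫ y, f y * ((‖y‖ ^ 2) ^ (k + 1))⁻¹ *
        iteratedDeriv k ψ ((q + inner ℝ y θ) / ‖y‖ ^ 2) : ℝ))
    (hkk.sub (continuous_const.mul (Complex.continuous_ofReal.comp hr))).continuousOn ?_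
  · have h1 := key (x := 0) ⟨by linarith, hδ⟩
    simp only [Pi.zero_apply, sub_eq_zero, zero_add] at h1
    rw [← h1]
    refine integral_congr_ae (.of_forall fun s => ?_)
    simp [coneIntegrand]
    norm_num
  intro η hη hηc hηs
  have hη0 : ∀ q, q ∉ Ioo (-(1 / (8 * b))) (1 / (8 * b)) → η q = 0 := fun q hq =>
    image_eq_zero_of_notMem_tsupport fun h => hq (hηs h)
  -- The same time average is evaluated twice: by the change of variable from t to q here, and by
  -- the weak formula in `e2`. Integration over s then compares the two.
  have e1 : ∀ s : ℝ, (ψ s * (s ^ k)⁻¹ : ℝ) *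
      ∫ t : ℝ, w ((1 / (2 * s)) • θ) t * η (s * t ^ 2 - 1 / (4 * s)) =
      ∫ q, η q * coneIntegrand k w θ ψ q s := by
    intro s
    by_cases hs : ψ s = 0
    · simp [coneIntegrand, hs]
    have hs0 : s ≠ 0 := fun h => hs (h ▸ hψ0)
    have hsb : |s| ≤ b := by simpa using hbs (subset_tsupport ψ hs)
    have hbb : b * (1 / (8 * b)) = 1 / 8 := by field_simp
    have hsδ : 4 * |s| * (1 / (8 * b)) ≤ 1 / 2 := by nlinarith
    rw [integral_comp_quadric (W := w ((1 / (2 * s)) • θ)) (by have := h.cont; fun_prop)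
      (h.even _) hs0 (hsδ.trans (by norm_num)) hη.continuous hη0, ← integral_const_mul]
    refine integral_congr_ae (.of_forall fun q => ?_)
    by_cases hq : q ∈ Ioo (-(1 / (8 * b))) (1 / (8 * b))
    · have h1 : |4 * s * q| ≤ 1 / 2 := by
        rw [abs_mul, abs_mul, abs_of_pos (by norm_num : (0 : ℝ) < 4)]
        exact (mul_le_mul_of_nonneg_left (abs_lt.2 hq).le (by positivity)).trans hsδ
      have h2 : max (1 + 4 * s * q) (1 / 2) = 1 + 4 * s * q :=
        max_eq_left (by linarith [(abs_le.1 h1).1])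
      simp only [coneIntegrand, h2]
      ring
    · simp [hη0 q hq]
  have e2 : ∀ s : ℝ, (ψ s * (s ^ k)⁻¹ : ℝ) *
      ∫ t : ℝ, w ((1 / (2 * s)) • θ) t * η (s * t ^ 2 - 1 / (4 * s)) =
      C * (-1) ^ k *
        (∫ y, f y * (ψ s * iteratedDeriv k η (s * ‖y‖ ^ 2 - inner ℝ y θ)) : ℝ) := by
    intro s
    by_cases hs : ψ s = 0
    · simp [hs]
    have hs0 : s ≠ 0 := fun h => hs (h ▸ hψ0)
    have h1 : ∫ y, (f y : ℂ) * (iteratedDeriv k η (s * ‖y‖ ^ 2 - inner ℝ y θ) : ℝ) =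
        ((∫ y, f y * iteratedDeriv k η (s * ‖y‖ ^ 2 - inner ℝ y θ) : ℝ) : ℂ) := by
      rw [← integral_complex_ofReal]
      simp only [Complex.ofReal_mul]
    have h2 : ∫ y, f y * (ψ s * iteratedDeriv k η (s * ‖y‖ ^ 2 - inner ℝ y θ)) =
        ψ s * ∫ y, f y * iteratedDeriv k η (s * ‖y‖ ^ 2 - inner ℝ y θ) := by
      rw [← integral_const_mul]
      refine integral_congr_ae (.of_forall fun y => ?_)
      simp only
      ring
    rw [h.weak_quadric hθ hs0 hη hηc, h1, h2]
    have h3 : (s : ℂ) ^ k ≠ 0 := pow_ne_zero _ (Complex.ofReal_ne_zero.2 hs0)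
    push_cast
    field_simp
  have e3 : ∫ s, ∫ q, η q * coneIntegrand k w θ ψ q s =
      ∫ q, η q * ∫ s, coneIntegrand k w θ ψ q s := by
    rw [integral_integral_swap_of_hasCompactSupport]
    · simp only [integral_const_mul]
    · exact ((Complex.continuous_ofReal.comp hη.continuous).comp continuous_snd).mul
        (hA.comp continuous_swap)
    · refine HasCompactSupport.intro (hψc.isCompact.prod hηc.isCompact) fun p hp => ?_
      rw [mem_prod, not_and_or] at hp
      rcases hp with hp | hp
      · simp [Function.uncurry, hA0 _ _ hp]
      · simp [Function.uncurry, image_eq_zero_of_notMem_tsupport hp]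
  have e4 : ∫ q, η q * ∫ s, coneIntegrand k w θ ψ q s = C * (-1) ^ k *
      ((∫ s, ∫ y, f y * (ψ s * iteratedDeriv k η (s * ‖y‖ ^ 2 - inner ℝ y θ)) : ℝ) : ℂ) := by
    rw [← e3, ← integral_complex_ofReal, ← integral_const_mul]
    refine integral_congr_ae (.of_forall fun s => ?_)
    simp only [← e1, e2]
  rw [integral_integral_iteratedDeriv_quadric k hf θ hψ hψc hη hηc] at e4
  have i1 : Integrable fun q => (η q : ℂ) * ∫ s, coneIntegrand k w θ ψ q s :=
    ((Complex.continuous_ofReal.comp hη.continuous).mul hkk).integrable_of_hasCompactSupport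
      (HasCompactSupport.intro hηc.isCompact fun q hq => by
        simp [image_eq_zero_of_notMem_tsupport hq])
  have i2 : Integrable fun q => η q * ∫ y, f y * ((‖y‖ ^ 2) ^ (k + 1))⁻¹ *
        iteratedDeriv k ψ ((q + inner ℝ y θ) / ‖y‖ ^ 2) :=
    (hη.continuous.mul hr).integrable_of_hasCompactSupport hηc.mul_right
  have i3 := integral_sub i1 (i2.ofReal.const_mul C)
  have e5 : ∫ q, ((η q * ∫ y, f y * ((‖y‖ ^ 2) ^ (k + 1))⁻¹ *
        iteratedDeriv k ψ ((q + inner ℝ y θ) / ‖y‖ ^ 2) : ℝ) : ℂ) =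
      ((∫ q, η q * ∫ y, f y * ((‖y‖ ^ 2) ^ (k + 1))⁻¹ *
        iteratedDeriv k ψ ((q + inner ℝ y θ) / ‖y‖ ^ 2) : ℝ) : ℂ) := integral_complex_ofReal
  rw [integral_const_mul, e4] at i3
  calc ∫ q, η q • ((∫ s, coneIntegrand k w θ ψ q s) - C * (∫ y, f y * ((‖y‖ ^ 2) ^ (k + 1))⁻¹ *
        iteratedDeriv k ψ ((q + inner ℝ y θ) / ‖y‖ ^ 2) : ℝ)) = _ := ?_
    _ = _ := i3
    _ = 0 := ?_
  · refine integral_congr_ae (.of_forall fun q => ?_)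
    simp only [Complex.real_smul, RCLike.ofReal_mul, Complex.coe_algebraMap]
    ring
  · have h1 : ((-1 : ℂ) ^ k) * (-1) ^ k = 1 := by rw [← mul_pow]; simp
    refine sub_eq_zero.2 ?_
    refine Eq.trans ?_ (congrArg _ e5).symm
    rw [Complex.ofReal_mul, Complex.ofReal_pow, Complex.ofReal_neg, Complex.ofReal_one,
      ← mul_assoc, mul_assoc C, h1, mul_one]

end Pairing

/-! ### Traces as derivatives of Radon transforms, and their inversion. -/

section Profile

variable {n : ℕ}

theorem hasCompactSupport_ofReal {ψ : ℝ → ℝ} (h : HasCompactSupport ψ) :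
    HasCompactSupport fun s => (ψ s : ℂ) :=
  HasCompactSupport.intro h.isCompact fun s hs => by
    rw [image_eq_zero_of_notMem_tsupport hs, Complex.ofReal_zero]

theorem hasCompactSupport_iteratedDeriv (k : ℕ) {ψ : ℝ → ℝ} (h : HasCompactSupport ψ) :
    HasCompactSupport (iteratedDeriv k ψ) := by
  induction k with
  | zero => simpa using h
  | succ k ih =>
    rw [iteratedDeriv_succ]
    exact ih.deriv

theorem integral_mul_iteratedDeriv_eq (k : ℕ) {R : ℝ → ℂ} (hR : ContDiff ℝ ∞ R) {ψ : ℝ → ℝ}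
    (hψ : ContDiff ℝ ∞ ψ) (hψc : HasCompactSupport ψ) :
    ∫ s, R s * (iteratedDeriv k ψ s : ℝ) = (-1) ^ k * ∫ s, iteratedDeriv k R s * ψ s := by
  induction k generalizing ψ with
  | zero => simp
  | succ k ih =>
    have hRk := contDiff_iteratedDeriv_infty k hR
    have hψ' := contDiff_deriv_infty hψ
    have c1 := (contDiff_iteratedDeriv_infty (k + 1) hR).continuous
    have c2 := hasCompactSupport_ofReal hψc
    have c3 := hasCompactSupport_ofReal hψc.deriv
    have d2 := Complex.continuous_ofReal.comp hψ.continuous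
    have d3 := Complex.continuous_ofReal.comp hψ'.continuous
    have key := integral_mul_deriv_eq_deriv_mul_of_integrable (u := iteratedDeriv k R)
      (u' := iteratedDeriv (k + 1) R) (v := fun s => (ψ s : ℂ)) (v' := fun s => ((deriv ψ s : ℝ) : ℂ))
      (fun s _ => by
        rw [iteratedDeriv_succ]
        exact (hRk.differentiable (by simp) s).hasDerivAt)
      (fun s _ => (hψ.differentiable (by simp) s).hasDerivAt.ofReal_comp)
      ((hRk.continuous.mul d3).integrable_of_hasCompactSupport c3.mul_left)
      ((c1.mul d2).integrable_of_hasCompactSupport c2.mul_left)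
      ((hRk.continuous.mul d2).integrable_of_hasCompactSupport c2.mul_left)
    rw [iteratedDeriv_succ' (f := ψ), ih hψ' hψc.deriv, key, pow_succ]
    ring

/-- Inversion carries the spheres s|y|² = y·θ to the hyperplanes z·θ = s, so the averages over
spheres found in `IsConeMean.integral_trace_mul` are those of a Radon transform. -/
theorem integral_radon_kelvin {m k : ℕ} (hnm : n = 2 * m + 1) (hk : k ≤ 2 * m) {f : E n → ℝ}
    (hf : IsTestFunctionOffZero f) {θ : E n} (hθ : ‖θ‖ = 1) {χ : ℝ → ℝ} (hχ : ContDiff ℝ ∞ χ)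
    (hχc : HasCompactSupport χ) :
    ∫ s, radon (toSchwartz (kelvin (2 * m - k) f) (hf.contDiff_kelvin _)
      (hf.hasCompactSupport_kelvin _)) hθ s * (χ s : ℂ) =
      (∫ y, f y * ((‖y‖ ^ 2) ^ (k + 1))⁻¹ * χ (inner ℝ y θ / ‖y‖ ^ 2) : ℝ) := by
  rw [← integral_kelvin_mul hnm hk f χ θ]
  exact integral_radon_mul _ hθ (HasCompactSupport.toSchwartzMap (f := fun s => (χ s : ℂ))
    (hasCompactSupport_ofReal hχc) (Complex.ofRealCLM.contDiff.comp hχ))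

/-- The trace of a cone mean on the light cone with vertex at the origin is a derivative of the
Radon transform of the inverted data. -/
theorem IsConeMean.trace_eq {m k : ℕ} (hnm : n = 2 * m + 1) (hk : k ≤ 2 * m) {C : ℂ} {f : E n → ℝ}
    (hf : IsTestFunctionOffZero f) {w : E n → ℝ → ℂ}
    (h : IsConeMean k C (fun y => (f y : ℂ)) w) {θ : E n} (hθ : ‖θ‖ = 1) {s : ℝ} (hs : s ≠ 0) :
    2 * ((s : ℂ) ^ k)⁻¹ * w ((1 / (2 * s)) • θ) (1 / (2 * |s|)) =
      C * (-1) ^ k * iteratedDeriv k (radon (toSchwartz (kelvin (2 * m - k) f)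
        (hf.contDiff_kelvin _) (hf.hasCompactSupport_kelvin _)) hθ) s := by
  set R := radon (toSchwartz (kelvin (2 * m - k) f)
        (hf.contDiff_kelvin _) (hf.hasCompactSupport_kelvin _)) hθ with hRdef
  have hR : ContDiff ℝ ∞ R := R.smooth ⊤
  have hRk := (contDiff_iteratedDeriv_infty k hR).continuous
  have hU : IsOpen {s : ℝ | s ≠ 0} := isOpen_ne
  have hL : ContinuousOn (fun s : ℝ => 2 * ((s : ℂ) ^ k)⁻¹ *
      w ((1 / (2 * s)) • θ) (1 / (2 * |s|))) {s : ℝ | s ≠ 0} := by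
    refine (continuousOn_const.mul (ContinuousOn.inv₀ (by fun_prop) fun s hs =>
      pow_ne_zero _ (Complex.ofReal_ne_zero.2 hs))).mul ?_
    refine h.cont.comp_continuousOn (f := fun s : ℝ => ((1 / (2 * s)) • θ, 1 / (2 * |s|))) ?_
    have h1 : ContinuousOn (fun s : ℝ => 1 / (2 * s)) {s : ℝ | s ≠ 0} :=
      continuousOn_const.div (by fun_prop) fun s hs => mul_ne_zero two_ne_zero hs
    refine ContinuousOn.prodMk (ContinuousOn.smul (f := fun s : ℝ => 1 / (2 * s))
      (g := fun _ => θ) h1 continuousOn_const) ?_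
    · exact continuousOn_const.div (by fun_prop) fun s hs =>
        mul_ne_zero two_ne_zero (abs_ne_zero.2 hs)
  -- Both sides are continuous for s ≠ 0 and have the same integrals against test functions ψ
  -- supported off 0, once the k derivatives on ψ are moved to the Radon transform.
  have key := eqOn_zero_of_integral_smul_eq_zero hU
    (g := fun s : ℝ => 2 * ((s : ℂ) ^ k)⁻¹ * w ((1 / (2 * s)) • θ) (1 / (2 * |s|)) -
      C * (-1) ^ k * iteratedDeriv k R s) (hL.sub (by fun_prop)) ?_
  · exact sub_eq_zero.1 (key hs)
  intro ψ hψ hψc hψs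
  have h0 : (0 : ℝ) ∉ tsupport ψ := fun h => hψs h rfl
  have hψk := contDiff_iteratedDeriv_infty k hψ
  have e2 := integral_radon_kelvin hnm hk hf hθ hψk (hasCompactSupport_iteratedDeriv k hψc)
  have e3 := h.integral_trace_mul hf hθ hψ hψc h0
  rw [← e2, integral_mul_iteratedDeriv_eq k hR hψ hψc] at e3
  have i1 : Integrable fun s : ℝ => (ψ s * (s ^ k)⁻¹ : ℝ) *
      (2 * w ((1 / (2 * s)) • θ) (1 / (2 * |s|))) := by
    refine Continuous.integrable_of_hasCompactSupport (continuous_of_tsupport fun s hs => ?_)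
      (HasCompactSupport.intro hψc.isCompact fun s hs => by
        simp [image_eq_zero_of_notMem_tsupport hs])
    have hs' : s ≠ 0 := by
      have h1 := closure_minimal (s := Function.support fun s : ℝ => ((ψ s * (s ^ k)⁻¹ : ℝ) : ℂ) *
        (2 * w ((1 / (2 * s)) • θ) (1 / (2 * |s|)))) (t := tsupport ψ) (fun s hs => by
          refine subset_tsupport ψ fun h => hs ?_
          simp [h]) (isClosed_tsupport ψ)
      exact hψs (h1 hs)
    have := (Complex.continuous_ofReal.comp hψ.continuous).continuousAt.mul
      (hL.continuousAt (hU.mem_nhds hs'))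
    refine this.congr (.of_forall fun s => ?_)
    simp only [Pi.mul_apply, Function.comp_apply]
    push_cast
    ring
  have i2 : Integrable fun s : ℝ => iteratedDeriv k R s * ψ s :=
    (hRk.mul (Complex.continuous_ofReal.comp hψ.continuous)).integrable_of_hasCompactSupport
      (HasCompactSupport.intro hψc.isCompact fun s hs => by
        simp [image_eq_zero_of_notMem_tsupport hs])
  have i3 := integral_sub i1 (i2.const_mul (C * (-1) ^ k))
  rw [e3, integral_const_mul, mul_assoc, sub_self] at i3
  rw [← i3]
  refine integral_congr_ae (.of_forall fun s => ?_)
  simp only [Complex.real_smul]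
  push_cast
  ring

/-- The profile of a cone mean along a line through the origin and its derivatives. -/
theorem contDiffOn_and_iteratedDeriv_of_eq {R : ℝ → ℂ} (hR : ContDiff ℝ ∞ R) {p : ℝ → ℝ} {c : ℝ}
    {k : ℕ} (h : ∀ s ≠ 0, p s = c * (iteratedDeriv k R s).re) :
    ContDiffOn ℝ ∞ p {s : ℝ | s ≠ 0} ∧
      ∀ j, ∀ s ≠ 0, iteratedDeriv j p s = c * (iteratedDeriv (j + k) R s).re := by
  have hk := contDiff_iteratedDeriv_infty k hR
  refine ⟨((contDiff_const.mul (Complex.reCLM.contDiff.comp hk)).contDiffOn).congr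
    fun s hs => h s hs, fun j s hs => ?_⟩
  have hU : IsOpen {s : ℝ | s ≠ 0} := isOpen_ne
  induction j generalizing s with
  | zero => simpa using h s hs
  | succ j ih =>
    have h1 : iteratedDeriv j p =ᶠ[nhds s] fun s => c * (iteratedDeriv (j + k) R s).re :=
      Filter.eventuallyEq_of_mem (hU.mem_nhds hs) fun s hs => ih s hs
    rw [iteratedDeriv_succ, h1.deriv_eq, Nat.add_right_comm, iteratedDeriv_succ (n := j + k)]
    have h2 := ((contDiff_iteratedDeriv_infty (j + k) hR).differentiable (by simp) s).hasDerivAt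
    have h3 := (Complex.reCLM.hasFDerivAt.comp_hasDerivAt s h2).const_mul c
    exact h3.deriv

/-- The surface measure is computed from cones, and the cone over this set lies in a proper
subspace. The exceptional directions are those where the profile is evaluated at s = 0. -/
theorem toSphere_hyperplane {x : E n} (hx : x ≠ 0) :
    (volume : Measure (E n)).toSphere {θ : sphere (0 : E n) 1 | inner ℝ x (θ : E n) = 0} = 0 := by
  have hms : MeasurableSet {θ : sphere (0 : E n) 1 | inner ℝ x (θ : E n) = 0} :=
    (isClosed_eq (by fun_prop) continuous_const).measurableSet
  rw [Measure.toSphere_apply' _ hms]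
  refine mul_eq_zero_of_right _ (measure_mono_null (t := ((ℝ ∙ x)ᗮ : Submodule ℝ (E n))) ?_ ?_)
  · rintro _ ⟨r, _, _, ⟨θ, hθ, rfl⟩, rfl⟩
    simp only [SetLike.mem_coe, Submodule.mem_orthogonal_singleton_iff_inner_right]
    rw [inner_smul_right, hθ, mul_zero]
  · refine Measure.addHaar_submodule _ _ fun h => hx ?_
    have h1 : x ∈ (ℝ ∙ x)ᗮ := h ▸ Submodule.mem_top
    exact inner_self_eq_zero.1 (Submodule.mem_orthogonal_singleton_iff_inner_right.1 h1)

/-- Inversion of a function by derivatives of its inverted Radon transform. -/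
theorem kelvin_radon_inversion {m : ℕ} (hnm : n = 2 * m + 1) {f : E n → ℝ}
    (hf : IsTestFunctionOffZero f) (i j k : ℕ) (hjk : j + k = 2 * m) {p : E n → ℝ → ℝ} {c : ℝ}
    (hp : ∀ θ : sphere (0 : E n) 1, ∀ s ≠ 0, p θ s = c * (iteratedDeriv k
      (radon (toSchwartz (kelvin i f) (hf.contDiff_kelvin _) (hf.hasCompactSupport_kelvin _))
        (norm_eq_of_mem_sphere θ)) s).re) :
    (∀ θ : sphere (0 : E n) 1, ContDiffOn ℝ ∞ (p θ) {s : ℝ | s ≠ 0}) ∧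
    ∀ x : E n, x ≠ 0 →
      Integrable (fun θ : sphere (0 : E n) 1 =>
        iteratedDeriv j (p θ) (inner ℝ x (θ : E n) / ‖x‖ ^ 2)) (sphereMeasure n) ∧
      ∫ θ : sphere (0 : E n) 1, iteratedDeriv j (p θ) (inner ℝ x (θ : E n) / ‖x‖ ^ 2)
        ∂(sphereMeasure n) =
        c * (2 * (-1) ^ m * (2 * Real.pi) ^ (2 * m)) * ((‖x‖ ^ 2) ^ i * f x) := by
  set F := toSchwartz (kelvin i f) (hf.contDiff_kelvin _) (hf.hasCompactSupport_kelvin _) with hF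
  have hd := fun θ : sphere (0 : E n) 1 => contDiffOn_and_iteratedDeriv_of_eq
    ((radon F (norm_eq_of_mem_sphere θ)).smooth ⊤) (hp θ)
  refine ⟨fun θ => (hd θ).1, fun x hx => ?_⟩
  obtain ⟨h1, h2⟩ := radon_inversion (V := E n) (m := m)
    (by rw [finrank_euclideanSpace_fin, hnm]) F ((‖x‖ ^ 2)⁻¹ • x)
  have hx2 : ‖x‖ ^ 2 ≠ 0 := pow_ne_zero _ (norm_ne_zero_iff.2 hx)
  -- At z = x/|x|² one has z·θ = x·θ/|x|², and the j derivatives of the profile complete the k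
  -- already present to the 2m of `radon_inversion`.
  have hae : (fun θ : sphere (0 : E n) 1 =>
      iteratedDeriv j (p θ) (inner ℝ x (θ : E n) / ‖x‖ ^ 2)) =ᵐ[sphereMeasure n]
      fun θ => c * (iteratedDeriv (2 * m) (radon F (norm_eq_of_mem_sphere θ))
        (inner ℝ ((‖x‖ ^ 2)⁻¹ • x) (θ : E n))).re := by
    have h3 : ∀ᵐ θ : sphere (0 : E n) 1 ∂(sphereMeasure n), inner ℝ x (θ : E n) ≠ 0 :=
      compl_mem_ae_iff.2 (toSphere_hyperplane hx)
    filter_upwards [h3] with θ hθ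
    rw [(hd θ).2 j _ (div_ne_zero hθ hx2), hjk, real_inner_smul_left, div_eq_inv_mul]
  refine ⟨(h1.re.const_mul c).congr hae.symm, ?_⟩
  have h4 := integral_re h1
  have h5 : F ((‖x‖ ^ 2)⁻¹ • x) = (((‖x‖ ^ 2) ^ i * f x : ℝ) : ℂ) := by
    rw [hF, toSchwartz_apply, kelvin_inversion i f hx]
  have h6 : 2 * (-1) ^ m * (2 * (Real.pi : ℂ)) ^ (2 * m) * F ((‖x‖ ^ 2)⁻¹ • x) =
      ((2 * (-1) ^ m * (2 * Real.pi) ^ (2 * m) * ((‖x‖ ^ 2) ^ i * f x) : ℝ) : ℂ) := by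
    rw [h5]
    push_cast
    ring
  rw [integral_congr_ae hae, integral_const_mul, mul_assoc c]
  refine congrArg (c * ·) (h4.trans ?_)
  rw [h2, h6]
  exact Complex.ofReal_re _

end Profile

/-! ### The profiles of 𝒰 and 𝒱, with constants. -/

section Assembly

variable {n : ℕ}

theorem norm_smul_unit {θ : E n} (hθ : ‖θ‖ = 1) (s : ℝ) : ‖(1 / (2 * s)) • θ‖ = 1 / (2 * |s|) := by
  rw [norm_smul, hθ, mul_one, Real.norm_eq_abs, abs_div, abs_mul, abs_one,
    abs_of_pos (by norm_num : (0 : ℝ) < 2)]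

theorem IsConeMean.re_trace_eq {m k : ℕ} (hnm : n = 2 * m + 1) (hk : k ≤ 2 * m) {C : ℝ}
    {f : E n → ℝ} (hf : IsTestFunctionOffZero f) {w : E n → ℝ → ℂ}
    (h : IsConeMean k C (fun y => (f y : ℂ)) w) {θ : E n} (hθ : ‖θ‖ = 1) {s : ℝ} (hs : s ≠ 0) :
    (s ^ k)⁻¹ * (w ((1 / (2 * s)) • θ) (1 / (2 * |s|))).re =
      C * (-1) ^ k / 2 * (iteratedDeriv k (radon (toSchwartz (kelvin (2 * m - k) f)
        (hf.contDiff_kelvin _) (hf.hasCompactSupport_kelvin _)) hθ) s).re := by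
  have h1 := h.trace_eq hnm hk hf hθ hs
  have h2 : 2 * ((s : ℂ) ^ k)⁻¹ = ((2 * (s ^ k)⁻¹ : ℝ) : ℂ) := by push_cast; ring
  have h3 : (C : ℂ) * (-1) ^ k = ((C * (-1) ^ k : ℝ) : ℂ) := by push_cast; ring
  rw [h2, h3] at h1
  have h4 := congrArg Complex.re h1
  rw [Complex.re_ofReal_mul, Complex.re_ofReal_mul] at h4
  linarith

theorem isWaveSolution_cosWave_toSchwartz {f : E n → ℝ} (hf : IsTestFunctionOffZero f) :
    IsWaveSolution f (fun _ => 0) fun x t => (cosWave (toSchwartz f hf.1 hf.2.1) x t).re := by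
  simpa only [toSchwartz_apply, Complex.ofReal_re] using
    isWaveSolution_cosWave (toSchwartz f hf.1 hf.2.1)

theorem isWaveSolution_sinWave_toSchwartz (hn : 2 ≤ n) {g : E n → ℝ}
    (hg : IsTestFunctionOffZero g) :
    IsWaveSolution (fun _ => 0) g fun x t => (sinWave (toSchwartz g hg.1 hg.2.1) x t).re := by
  simpa only [toSchwartz_apply, Complex.ofReal_re] using
    isWaveSolution_sinWave hn (toSchwartz g hg.1 hg.2.1)

theorem profileU_eq {m : ℕ} (hm : 1 ≤ m) (hnm : n = 2 * m + 1) {f : E n → ℝ}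
    (hf : IsTestFunctionOffZero f) {θ : E n} (hθ : ‖θ‖ = 1) {s : ℝ} (hs : s ≠ 0) :
    profileU m f θ s = (Real.pi ^ m)⁻¹ * (-1) ^ m / 2 *
      (iteratedDeriv m (radon (toSchwartz (kelvin m f) (hf.contDiff_kelvin _)
        (hf.hasCompactSupport_kelvin _)) hθ) s).re := by
  have h1 : IsConeMean m (((Real.pi ^ m)⁻¹ : ℝ) : ℂ) (fun y => (f y : ℂ))
      (cosWave (toSchwartz f hf.1 hf.2.1)) := by
    have := isConeMean_cosWave hnm (toSchwartz f hf.1 hf.2.1)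
    rw [one_div] at this
    exact_mod_cast this
  have h2 := h1.re_trace_eq hnm (by omega) hf hθ hs
  have h3 : 2 * m - m = m := by omega
  simp only [h3] at h2
  rw [profileU, U, waveSolution_eq hm hnm (isWaveSolution_cosWave_toSchwartz hf),
    norm_smul_unit hθ, one_div, h2]

theorem profileV_eq {m : ℕ} (hm : 1 ≤ m) (hnm : n = 2 * m + 1) {g : E n → ℝ}
    (hg : IsTestFunctionOffZero g) {θ : E n} (hθ : ‖θ‖ = 1) {s : ℝ} (hs : s ≠ 0) :
    profileV m g θ s = (2 * Real.pi ^ m)⁻¹ * (-1) ^ (m - 1) *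
      (iteratedDeriv (m - 1) (radon (toSchwartz (kelvin (m + 1) g) (hg.contDiff_kelvin _)
        (hg.hasCompactSupport_kelvin _)) hθ) s).re := by
  have h1 : IsConeMean (m - 1) (((2 * Real.pi ^ m)⁻¹ : ℝ) : ℂ) (fun y => (g y : ℂ))
      (fun x t => t * sinWave (toSchwartz g hg.1 hg.2.1) x t) := by
    have := isConeMean_sinWave hm hnm (toSchwartz g hg.1 hg.2.1)
    rw [one_div] at this
    exact_mod_cast this
  have h2 := h1.re_trace_eq hnm (by omega) hg hθ hs
  have h3 : 2 * m - (m - 1) = m + 1 := by omega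
  simp only [h3, Complex.re_ofReal_mul] at h2
  rw [profileV, V, waveSolution_eq hm hnm (isWaveSolution_sinWave_toSchwartz (by omega) hg),
    norm_smul_unit hθ]
  -- On the cone t = 1/(2|s|), so the factor t in the cone mean of the sine solution is the source
  -- of |s| in the profile.
  have h4 : 1 / (s ^ (m - 1) * |s|) = 2 * ((s ^ (m - 1))⁻¹ * (1 / (2 * |s|))) := by
    rw [one_div, mul_inv, one_div, mul_inv]
    ring
  rw [h4]
  linear_combination 2 * h2

theorem pi_constant (m : ℕ) :
    (Real.pi ^ m)⁻¹ * (2 * Real.pi) ^ (2 * m) = (4 * Real.pi) ^ m := by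
  have h1 : (2 * Real.pi) ^ (2 * m) = (4 * Real.pi) ^ m * Real.pi ^ m := by
    rw [pow_mul, ← mul_pow]
    ring
  rw [h1]
  field_simp

end Assembly

end ConeTrace

end

theorem theorem2 (n m : ℕ) (hn : 3 ≤ n) (hnm : n = 2 * m + 1)
    (f g : ConeTrace.E n → ℝ)
    (hf : ConeTrace.IsTestFunctionOffZero f) (hg : ConeTrace.IsTestFunctionOffZero g) :
    ((∃! u : ConeTrace.E n → ℝ → ℝ, ConeTrace.IsWaveSolution f (fun _ => 0) u) ∧
      (∀ θ : sphere (0 : ConeTrace.E n) 1,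
        ContDiffOn ℝ ∞ (ConeTrace.profileU m f θ) {s : ℝ | s ≠ 0}) ∧
      ∀ x : ConeTrace.E n, x ≠ 0 →
        Integrable (fun θ : sphere (0 : ConeTrace.E n) 1 =>
          iteratedDeriv m (ConeTrace.profileU m f θ) (inner ℝ x (θ : ConeTrace.E n) / ‖x‖ ^ 2))
          (ConeTrace.sphereMeasure n) ∧
        f x = 1 / ((4 * Real.pi) ^ m * ‖x‖ ^ (2 * m)) *
          ∫ θ : sphere (0 : ConeTrace.E n) 1,
            iteratedDeriv m (ConeTrace.profileU m f θ)
              (inner ℝ x (θ : ConeTrace.E n) / ‖x‖ ^ 2) ∂(ConeTrace.sphereMeasure n)) ∧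
    ((∃! v : ConeTrace.E n → ℝ → ℝ, ConeTrace.IsWaveSolution (fun _ => 0) g v) ∧
      (∀ θ : sphere (0 : ConeTrace.E n) 1,
        ContDiffOn ℝ ∞ (ConeTrace.profileV m g θ) {s : ℝ | s ≠ 0}) ∧
      ∀ x : ConeTrace.E n, x ≠ 0 →
        Integrable (fun θ : sphere (0 : ConeTrace.E n) 1 =>
          iteratedDeriv (m + 1) (ConeTrace.profileV m g θ)
            (inner ℝ x (θ : ConeTrace.E n) / ‖x‖ ^ 2))
          (ConeTrace.sphereMeasure n) ∧
        g x = -1 / ((4 * Real.pi) ^ m * ‖x‖ ^ (n + 1)) *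
          ∫ θ : sphere (0 : ConeTrace.E n) 1,
            iteratedDeriv (m + 1) (ConeTrace.profileV m g θ)
              (inner ℝ x (θ : ConeTrace.E n) / ‖x‖ ^ 2) ∂(ConeTrace.sphereMeasure n)) := by
  have hm : 1 ≤ m := by omega
  have hpi : (0 : ℝ) < (4 * Real.pi) ^ m := by positivity
  have hsq : ((-1 : ℝ) ^ m) ^ 2 = 1 := by rw [← pow_mul, mul_comm, pow_mul, neg_one_sq, one_pow]
  obtain ⟨hU1, hU2⟩ := ConeTrace.kelvin_radon_inversion hnm hf m m m (by omega)
    (fun θ s hs => ConeTrace.profileU_eq hm hnm hf (norm_eq_of_mem_sphere θ) hs)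
  -- The sine trace already carries m - 1 derivatives, so m + 1 remain; the Kelvin weight is 2m - (m
  -- - 1) = m + 1, whence the power |x|^(n+1).
  obtain ⟨hV1, hV2⟩ := ConeTrace.kelvin_radon_inversion hnm hg (m + 1) (m + 1) (m - 1) (by omega)
    (fun θ s hs => ConeTrace.profileV_eq hm hnm hg (norm_eq_of_mem_sphere θ) hs)
  refine ⟨⟨⟨_, ConeTrace.isWaveSolution_cosWave_toSchwartz hf, fun u hu => hu.unique hm hnm
      (ConeTrace.isWaveSolution_cosWave_toSchwartz hf)⟩, hU1, fun x hx => ⟨(hU2 x hx).1, ?_⟩⟩,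
    ⟨⟨_, ConeTrace.isWaveSolution_sinWave_toSchwartz (by omega) hg, fun u hu => hu.unique hm hnm
      (ConeTrace.isWaveSolution_sinWave_toSchwartz (by omega) hg)⟩, hV1,
      fun x hx => ⟨(hV2 x hx).1, ?_⟩⟩⟩
  · have hx' : ‖x‖ ^ (2 * m) ≠ 0 := pow_ne_zero _ (norm_ne_zero_iff.2 hx)
    have h1 : (Real.pi ^ m)⁻¹ * (-1) ^ m / 2 * (2 * (-1) ^ m * (2 * Real.pi) ^ (2 * m)) =
        (4 * Real.pi) ^ m := by
      rw [← ConeTrace.pi_constant]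
      linear_combination (Real.pi ^ m)⁻¹ * (2 * Real.pi) ^ (2 * m) * hsq
    rw [(hU2 x hx).2, h1, ← pow_mul]
    field_simp
  · have hx' : ‖x‖ ^ (n + 1) ≠ 0 := pow_ne_zero _ (norm_ne_zero_iff.2 hx)
    -- The signs (-1)^(m-1) and (-1)^m multiply to -1, the minus sign of the second formula.
    have h1 : (2 * Real.pi ^ m)⁻¹ * (-1) ^ (m - 1) *
        (2 * (-1) ^ m * (2 * Real.pi) ^ (2 * m)) = -(4 * Real.pi) ^ m := by
      obtain ⟨l, rfl⟩ := Nat.exists_eq_add_of_le' hm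
      rw [← ConeTrace.pi_constant, mul_inv, Nat.add_sub_cancel]
      rw [pow_succ (-1 : ℝ)] at hsq ⊢
      linear_combination -(Real.pi ^ (l + 1))⁻¹ * (2 * Real.pi) ^ (2 * (l + 1)) * hsq
    have h2 : 2 * (m + 1) = n + 1 := by omega
    rw [(hV2 x hx).2, h1, ← pow_mul, h2]
    field_simp
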